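/- Let $\Theta$ be a compact smooth Riemannian manifold without boundary, of dimension $d_\theta\ge 1$, with Riemannian volume measure $\mathrm{vol}$. Let $(x_i,y_i)_{i=1}^N$, $N\ge1$, be data with $x_i\in\mathbb R^{d_x}$, let $\varepsilon>0$, $\mathbb B_\varepsilon(x_i)=\{x:\|x-x_i\|_\infty\le\varepsilon\}$, and let $\mathcal X\subseteq\mathbb R^{d_x}$ contain all these balls. Let $\ell:\Theta\times(\mathcal X\times\mathcal Y)\to[0,U]$ be continuously differentiable in $\theta$, and $G$-Lipschitz in $\theta$ (Riemannian distance) and in $x$ ($\ell_\infty$ norm). For a probability measure $\mu$ on $\Theta$ and $\nu=(\nu_1,\dots,\nu_N)$ with $\nu_i$ a probability measure on $\mathbb B_\varepsilon(x_i)$, put $$V_\nu(\theta)=\frac1N\sum_{i=1}^N\mathbb E_{x\sim\nu_i}[\ell(\theta,(x,y_i))],\qquad \mathcal L(\mu,\nu)=\int_\Theta V_\nu\,d\mu .$$ Let $\alpha,\beta>0$, $\gamma\ge0$, and let $(\mu(t),\nu(t))_{t\ge0}$ be a WFR-LBR flow started at $(\mu^0,\nu^0)$, i.e.: * $t\mapsto\mu(t)$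 is a narrowly continuous path of probability measures on $\Theta$ with $\mu(0)=\mu^0$ that solves $$\partial_t\mu=\gamma\,\nabla\!\cdot(\mu\nabla V_{\nu(t)})-\alpha\,\mu\Big(V_{\nu(t)}-\int V_{\nu(t)}\,d\mu\Big)$$ weakly, tested against all $C^1$ functions on $\Theta$; * $\nu(t)=\nu^0$ for $0\le t<1$, where $\nu^0_i$ is a probability measure on $\mathbb B_\varepsilon(x_i)$; and for $t\ge1$, $\nu_i(t)$ is the probability measure on $\mathbb B_\varepsilon(x_i)$ whose Lebesgue density is proportional to $\exp(\beta^{-1}\mathbb E_{\theta\sim\bar\mu(t)}[\ell(\theta,(x,y_i))])$, where $\bar\mu(t)=\frac1t\int_0^t\mu(s)\,ds$. Let $K\in\mathbb R$ be such that $\mu^0\ge e^{-K}\,\mathrm{vol}$ as measures (e.g. $\mu^0$ has a density with respect to $\mathrm{vol}$ that is at least $e^{-K}$). Write $\bar\nu(T)=\frac1T\int_0^T\nu(t)\,dt$. Then for every $\tau_0>0$ there is a constant $K'$ depending only on $\Theta$ and $\tau_0$ such that, for all data as above and every $T>0$ with $\alpha T(U+G)\ge\tau_0$: the function $t\mapsto\mathcal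 L(\mu(t),\nu(t))$ is integrable on $[0,T]$, a minimizer $\mu^*(T)$ of $\mathcal L(\cdot,\bar\nu(T))$ over the probability measures on $\Theta$ exists, and every such minimizer satisfies $$\frac1T\int_0^T\mathcal L(\mu(t),\nu(t))\,dt-\mathcal L(\mu^*(T),\bar\nu(T))\le\frac{d_\theta}{\alpha T}\big(1-\log d_\theta+\log(\alpha T(U+G))\big)+\frac{K+K'}{\alpha T}+\frac{\gamma(U+G)^2T}{2}.$$ -/

import Mathlib

open Set MeasureTheory Bundle Manifold
open scoped ENNReal NNReal ContDiff

noncomputable section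

namespace AdvTraining

/-- Input space `ℝ^{d_x}`; the metric of `Fin d_x → ℝ` is the `ℓ_∞` metric. -/
abbrev Input (dx : ℕ) : Type := Fin dx → ℝ

/-- `𝔹_ε(x) = {x' : ‖x' - x‖_∞ ≤ ε}`, the set of admissible perturbations of `x`. -/
def attackBall {dx : ℕ} (ε : ℝ) (x : Input dx) : Set (Input dx) :=
  Metric.closedBall x ε

section Game

variable {Θ Y : Type*} [MeasurableSpace Θ] {dx N : ℕ}

/-- First variation of the risk in the classifier's strategy:
`V_ν(θ) = (1/N) ∑ᵢ 𝔼_{x ∼ νᵢ} ℓ(θ, (x, yᵢ))`. -/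
def potential (ℓ : Θ → Input dx → Y → ℝ) (y : Fin N → Y)
    (ν : Fin N → Measure (Input dx)) (θ : Θ) : ℝ :=
  (1 / (N : ℝ)) * ∑ i, ∫ x, ℓ θ x (y i) ∂(ν i)

/-- Adversarial risk `𝓛(μ, ν) = (1/N) ∑ᵢ 𝔼_{θ ∼ μ, x ∼ νᵢ} ℓ(θ, (x, yᵢ))`. -/
def risk (ℓ : Θ → Input dx → Y → ℝ) (y : Fin N → Y)
    (μ : Measure Θ) (ν : Fin N → Measure (Input dx)) : ℝ :=
  (1 / (N : ℝ)) * ∑ i, ∫ θ, ∫ x, ℓ θ x (y i) ∂(ν i) ∂μ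

/-- Time average `(1/t) ∫₀ᵗ m(s) ds` of a path of measures. -/
def timeAvg {Ω : Type*} [MeasurableSpace Ω] (m : ℝ → Measure Ω) (t : ℝ) : Measure Ω :=
  ENNReal.ofReal t⁻¹ • (volume.restrict (Ioc 0 t)).bind m

/-- Componentwise time average `ν̄(t) = (1/t) ∫₀ᵗ ν(s) ds` of the attacker's strategy. -/
def avgAttacker (ν : ℝ → Fin N → ProbabilityMeasure (Input dx)) (t : ℝ) :
    Fin N → Measure (Input dx) :=
  fun i => timeAvg (fun s => (ν s i : Measure (Input dx))) t

/-- Logit best response to `μ` on one data point `(x, y)`: the law on `𝔹_ε(x)` with Lebesgue density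
`exp(β⁻¹ 𝔼_{θ∼μ} ℓ(θ, (x', y))) / ∫_{𝔹_ε(x)} exp(β⁻¹ 𝔼_{θ∼μ} ℓ(θ, (z, y))) dz`. -/
def logitResponse (β ε : ℝ) (ℓ : Θ → Input dx → Y → ℝ) (x : Input dx) (y : Y)
    (μ : Measure Θ) : Measure (Input dx) :=
  (volume.restrict (attackBall ε x)).tilted fun x' => β⁻¹ * ∫ θ, ℓ θ x' y ∂μ

/-- `μ` minimises `𝓛(·, ν)` over all probability measures on `Θ`. -/
def IsClassifierBestResponse (ℓ : Θ → Input dx → Y → ℝ) (y : Fin N → Y)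
    (ν : Fin N → Measure (Input dx)) (μ : ProbabilityMeasure Θ) : Prop :=
  ∀ μ' : ProbabilityMeasure Θ, risk ℓ y (μ : Measure Θ) ν ≤ risk ℓ y (μ' : Measure Θ) ν

end Game

section Flow

variable {Θ : Type*} [EMetricSpace Θ]

/-- Standing assumptions on the loss over the input set `𝓧`: values in `[0, U]`, continuously
differentiable in `θ`, and `G`-Lipschitz in `θ` (Riemannian distance) and in `x` (`ℓ_∞`
distance). -/
structure IsAdmissibleLoss {Y : Type*} {dx : ℕ} (d : ℕ) [ChartedSpace (EuclideanSpace ℝ (Fin d)) Θ]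
    (U : ℝ) (G : ℝ≥0) (𝓧 : Set (Input dx)) (ℓ : Θ → Input dx → Y → ℝ) : Prop where
  nonneg : ∀ θ, ∀ x ∈ 𝓧, ∀ y, 0 ≤ ℓ θ x y
  le_bound : ∀ θ, ∀ x ∈ 𝓧, ∀ y, ℓ θ x y ≤ U
  contMDiff_param : ∀ x ∈ 𝓧, ∀ y,
    ContMDiff 𝓘(ℝ, EuclideanSpace ℝ (Fin d)) 𝓘(ℝ, ℝ) 1 fun θ => ℓ θ x y
  lipschitz_param : ∀ x ∈ 𝓧, ∀ y, LipschitzWith G fun θ => ℓ θ x y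
  lipschitz_input : ∀ θ y, LipschitzOnWith G (fun x => ℓ θ x y) 𝓧

/-- Riemannian gradient: the tangent vector representing the differential. -/
def riemannianGrad (d : ℕ) {Θ : Type*} [EMetricSpace Θ]
    [ChartedSpace (EuclideanSpace ℝ (Fin d)) Θ]
    [IsManifold 𝓘(ℝ, EuclideanSpace ℝ (Fin d)) ∞ Θ]
    [RiemannianBundle (fun θ : Θ => TangentSpace 𝓘(ℝ, EuclideanSpace ℝ (Fin d)) θ)]
    (f : Θ → ℝ) (θ : Θ) : TangentSpace 𝓘(ℝ, EuclideanSpace ℝ (Fin d)) θ :=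
  haveI : FiniteDimensional ℝ (TangentSpace 𝓘(ℝ, EuclideanSpace ℝ (Fin d)) θ) :=
    inferInstanceAs (FiniteDimensional ℝ (EuclideanSpace ℝ (Fin d)))
  haveI : CompleteSpace (TangentSpace 𝓘(ℝ, EuclideanSpace ℝ (Fin d)) θ) :=
    FiniteDimensional.complete ℝ _
  (InnerProductSpace.toDual ℝ (TangentSpace 𝓘(ℝ, EuclideanSpace ℝ (Fin d)) θ)).symm
    (mfderiv 𝓘(ℝ, EuclideanSpace ℝ (Fin d)) 𝓘(ℝ, ℝ) f θ)

/-- `μ` is a narrowly continuous path of probability measures, started at `μ⁰`, that solves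
`∂ₜμ = γ ∇·(μ ∇V_{ν(t)}) - α μ (V_{ν(t)} - ∫ V_{ν(t)} dμ)` weakly on `[0, ∞)`. -/
structure IsWFRSolution {Y : Type*} {dx N : ℕ} [MeasurableSpace Θ] [BorelSpace Θ] (d : ℕ)
    [ChartedSpace (EuclideanSpace ℝ (Fin d)) Θ]
    [IsManifold 𝓘(ℝ, EuclideanSpace ℝ (Fin d)) ∞ Θ]
    [RiemannianBundle (fun θ : Θ => TangentSpace 𝓘(ℝ, EuclideanSpace ℝ (Fin d)) θ)]
    (α γ : ℝ) (ℓ : Θ → Input dx → Y → ℝ) (y : Fin N → Y) (μ₀ : ProbabilityMeasure Θ)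
    (ν : ℝ → Fin N → Measure (Input dx)) (μ : ℝ → ProbabilityMeasure Θ) : Prop where
  initial : μ 0 = μ₀
  continuousOn : ContinuousOn μ (Ici 0)
  weak : ∀ ψ : Θ → ℝ, ContMDiff 𝓘(ℝ, EuclideanSpace ℝ (Fin d)) 𝓘(ℝ, ℝ) 1 ψ → ∀ t, 0 ≤ t →
    ∫ θ, ψ θ ∂(μ t : Measure Θ) = ∫ θ, ψ θ ∂(μ₀ : Measure Θ) +
      ∫ s in (0 : ℝ)..t,
        (-γ * ∫ θ, inner ℝ (riemannianGrad d (potential ℓ y (ν s)) θ) (riemannianGrad d ψ θ)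
            ∂(μ s : Measure Θ)
          - α * ∫ θ, ψ θ * (potential ℓ y (ν s) θ
              - ∫ θ', potential ℓ y (ν s) θ' ∂(μ s : Measure Θ)) ∂(μ s : Measure Θ))

/-- The WFR-LBR flow: the classifier follows the Wasserstein–Fisher–Rao gradient flow of
`𝓛(·, ν(t))`; the attacker plays `ν⁰ ∈ Σ` for `0 ≤ t < 1` and, for `t ≥ 1`, the logit best
response (temperature `β`) to the time-averaged classifier `(1/t) ∫₀ᵗ μ(s) ds`. -/
structure IsWFRLBRFlow {Y : Type*} {dx N : ℕ} [MeasurableSpace Θ] [BorelSpace Θ] (d : ℕ)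
    [ChartedSpace (EuclideanSpace ℝ (Fin d)) Θ]
    [IsManifold 𝓘(ℝ, EuclideanSpace ℝ (Fin d)) ∞ Θ]
    [RiemannianBundle (fun θ : Θ => TangentSpace 𝓘(ℝ, EuclideanSpace ℝ (Fin d)) θ)]
    (α γ β ε : ℝ) (ℓ : Θ → Input dx → Y → ℝ) (x : Fin N → Input dx) (y : Fin N → Y)
    (μ₀ : ProbabilityMeasure Θ) (ν₀ : Fin N → ProbabilityMeasure (Input dx))
    (μ : ℝ → ProbabilityMeasure Θ) (ν : ℝ → Fin N → ProbabilityMeasure (Input dx)) : Prop where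
  classifier : IsWFRSolution d α γ ℓ y μ₀ (fun t i => (ν t i : Measure (Input dx))) μ
  attacker_supported : ∀ i, (ν₀ i : Measure (Input dx)) (attackBall ε (x i))ᶜ = 0
  attacker_initial : ∀ t, 0 ≤ t → t < 1 → ν t = ν₀
  attacker_response : ∀ t, 1 ≤ t → ∀ i, (ν t i : Measure (Input dx)) =
    logitResponse β ε ℓ (x i) (y i) (timeAvg (fun s => (μ s : Measure Θ)) t)

end Flow
end AdvTraining
end

/-!
The regret bound rests on one inequality for the Wasserstein–Fisher–Rao equation, which uses only
its weak formulation: no flow map, no density and no entropy of `μ(t)` is needed.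

Write `V_t` for the potential of the attacker at time `t` and `w_t = ∫ V_t dμ_t` for the risk. For a
fixed horizon `T` let
`Φ_s(θ) = ∫_s^T V_r(θ) dr + ∫_0^s w_r dr + γ G² (T - s)² / 2`  and  `ψ_s = exp(-α Φ_s)`.
Then `s ↦ ∫ ψ_s dμ_s` is nondecreasing. Formally, its derivative is
`∫ (∂_s ψ_s - γ ⟪∇V_s, ∇ψ_s⟫ - α ψ_s (V_s - w_s)) dμ_s`. Since
`∂_s ψ_s = α ψ_s (V_s - w_s + γ G² (T - s))`, the reaction term cancels, and
`∇ψ_s = -α ψ_s ∇Φ_s` with `‖∇Φ_s‖ ≤ G (T - s)` and `‖∇V_s‖ ≤ G`, so the last summand of `Φ_s` pays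
for the transport term. As `V` is only measurable in time, the derivative is replaced by a lower
bound `-C (t - s)²` on increments (`IsWFRPath.exists_integral_expTest_sub_ge`), which suffices by
subdivision (`le_of_forall_sub_ge_neg_sq`). Comparing `s = 0` with `s = T` gives
`IsWFRPath.exp_mean_ge`:
`∫ exp(-α (∫_0^T V_r dr + γ G² T² / 2)) dμ⁰ ≤ exp(-α ∫_0^T w_r dr)`.

Restricting the left side to a ball of radius `r` around a minimiser `θ` of the averaged potential
and taking logarithms bounds the regret by `G r + γ G² T / 2 - log (μ⁰(ball)) / (α T)`
(`IsWFRPath.integral_mean_le`). On a compact Riemannian manifold balls of radius `r ≤ R` have volume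
at least `c r ^ d` (`exists_measure_eball_ge`), because charts are locally bi-Lipschitz. The choice
`r = d / (α T (U + G)) ≤ d / τ₀` then yields the bound with `K' = -log c`.

Admissibility of the test functions is geometric: `C¹` functions have a gradient bounded by their
Lipschitz constant (`abs_scalarDifferential_le_of_lipschitzWith`), gradient pairings are continuous
(`continuous_inner_of_representing`), and averages of uniformly Lipschitz `C¹` functions are `C¹`
(`contMDiff_integral`).
-/

noncomputable section

open Filter Topology
open AdvTraining

/-! ### Riemannian distance and differentials in charts -/

section RiemannianGeometry

variable {E : Type*} [NormedAddCommGroup E] [NormedSpace ℝ E]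
  {M : Type*} [EMetricSpace M] [ChartedSpace E M] [IsManifold 𝓘(ℝ, E) ∞ M]
  [RiemannianBundle (fun θ : M => TangentSpace 𝓘(ℝ, E) θ)]
  [IsContinuousRiemannianBundle E (fun θ : M => TangentSpace 𝓘(ℝ, E) θ)]
  [IsRiemannianManifold 𝓘(ℝ, E) M]

omit [IsContinuousRiemannianBundle E (fun θ : M => TangentSpace 𝓘(ℝ, E) θ)] in
/-- Mean value inequality for the inverse of a chart: the Riemannian distance is at most the length
of the image of the segment `[a, b]`. -/
lemma edist_extChartAt_symm_le {x : M} {a b : E} {B : ℝ≥0∞}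
    (hseg : segment ℝ a b ⊆ (extChartAt 𝓘(ℝ, E) x).target)
    (hB : ∀ z ∈ segment ℝ a b,
      ‖mfderivWithin 𝓘(ℝ, E) 𝓘(ℝ, E) (extChartAt 𝓘(ℝ, E) x).symm (range 𝓘(ℝ, E)) z (b - a)‖ₑ ≤ B) :
    edist ((extChartAt 𝓘(ℝ, E) x).symm a) ((extChartAt 𝓘(ℝ, E) x).symm b) ≤ B := by
  let η := ContinuousAffineMap.lineMap (R := ℝ) a b
  set γ := (extChartAt 𝓘(ℝ, E) x).symm ∘ η
  have hη' : MapsTo η (Icc 0 1) (segment ℝ a b) := by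
    rw [mapsTo_iff_image_subset, segment_eq_image_lineMap]
    exact subset_rfl
  have hη : Icc 0 1 ⊆ η ⁻¹' (extChartAt 𝓘(ℝ, E) x).target := fun t ht => hseg (hη' ht)
  have η_smooth : CMDiff[Icc 0 1] 1 η := by
    apply ContMDiff.contMDiffOn
    rw [contMDiff_iff_contDiff]
    exact ContinuousAffineMap.contDiff _
  rw [IsRiemannianManifold.out (I := 𝓘(ℝ, E))]
  have h1 : riemannianEDist 𝓘(ℝ, E) ((extChartAt 𝓘(ℝ, E) x).symm a)
      ((extChartAt 𝓘(ℝ, E) x).symm b) ≤ pathELength 𝓘(ℝ, E) γ 0 1 := by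
    apply riemannianEDist_le_pathELength _ _ _ zero_le_one
    · exact (contMDiffOn_extChartAt_symm x).comp η_smooth hη
    · simp [γ, η, ContinuousAffineMap.coe_lineMap_eq]
    · simp [γ, η, ContinuousAffineMap.coe_lineMap_eq]
  refine h1.trans ?_
  rw [pathELength_eq_lintegral_mfderivWithin_Icc]
  have h2 : ∫⁻ t in Icc (0 : ℝ) 1, B = B := by simp
  rw [← h2]
  apply setLIntegral_mono' measurableSet_Icc (fun t ht ↦ ?_)
  have h3 : mfderiv[Icc 0 1] γ t =
      (mfderiv[range 𝓘(ℝ, E)] (extChartAt 𝓘(ℝ, E) x).symm (η t)) ∘L (mfderiv[Icc 0 1] η t) := by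
    apply mfderivWithin_comp
    · exact mdifferentiableWithinAt_extChartAt_symm (hη ht)
    · exact η_smooth.mdifferentiableOn one_ne_zero t ht
    · exact hη.trans (preimage_mono (extChartAt_target_subset_range x))
    · rw [uniqueMDiffWithinAt_iff_uniqueDiffWithinAt]
      exact uniqueDiffOn_Icc zero_lt_one t ht
  have h4 : mfderiv[Icc 0 1] η t 1 = b - a := by
    rw [mfderivWithin_eq_fderivWithin]
    have : fderivWithin ℝ (ContinuousAffineMap.lineMap (R := ℝ) a b) (Icc 0 1) t
      = fderiv ℝ (ContinuousAffineMap.lineMap (R := ℝ) a b) t :=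
      fderivWithin_eq_fderiv (uniqueDiffOn_Icc zero_lt_one _ ht)
        (ContinuousAffineMap.differentiableAt _)
    change fderivWithin ℝ (ContinuousAffineMap.lineMap (R := ℝ) a b) (Icc 0 1) t 1 = _
    rw [this]
    simp
  have h5 : mfderiv[Icc 0 1] γ t 1 =
      (mfderiv[range 𝓘(ℝ, E)] (extChartAt 𝓘(ℝ, E) x).symm (η t)) (mfderiv[Icc 0 1] η t 1) :=
    congr($h3 1)
  rw [h5, h4]
  exact hB _ (hη' ht)

/-- The differential of a real function on a manifold, as a linear form on the tangent space. -/
def scalarDifferential (f : M → ℝ) (x : M) : TangentSpace 𝓘(ℝ, E) x →L[ℝ] ℝ :=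
  mfderiv 𝓘(ℝ, E) 𝓘(ℝ, ℝ) f x

omit [RiemannianBundle (fun θ : M => TangentSpace 𝓘(ℝ, E) θ)]
  [IsContinuousRiemannianBundle E (fun θ : M => TangentSpace 𝓘(ℝ, E) θ)]
  [IsRiemannianManifold 𝓘(ℝ, E) M] in
/-- The differential of `f` read in the chart at `x`, at a point `y` of its source, is the
differential of `f` at `y` composed with the trivialization of the tangent bundle at `x`. -/
lemma hasFDerivAt_comp_extChartAt_symm {f : M → ℝ} {x y : M} (hy : y ∈ (chartAt E x).source)
    (hf : MDifferentiableAt 𝓘(ℝ, E) 𝓘(ℝ, ℝ) f y) :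
    HasFDerivAt (f ∘ (extChartAt 𝓘(ℝ, E) x).symm)
      ((scalarDifferential f y) ∘L
        (trivializationAt E (TangentSpace 𝓘(ℝ, E)) x).symmL ℝ y) (extChartAt 𝓘(ℝ, E) x y) := by
  have hys : (extChartAt 𝓘(ℝ, E) x).symm (extChartAt 𝓘(ℝ, E) x y) = y :=
    (extChartAt 𝓘(ℝ, E) x).left_inv (by simpa using hy)
  rw [TangentBundle.symmL_trivializationAt hy]
  have hT : extChartAt 𝓘(ℝ, E) x y ∈ (extChartAt 𝓘(ℝ, E) x).target :=
    (extChartAt 𝓘(ℝ, E) x).map_source (by simpa using hy)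
  have h1 : MDifferentiableWithinAt 𝓘(ℝ, E) 𝓘(ℝ, E) (extChartAt 𝓘(ℝ, E) x).symm
    (range 𝓘(ℝ, E)) (extChartAt 𝓘(ℝ, E) x y) := mdifferentiableWithinAt_extChartAt_symm hT
  have h2 := h1.hasMFDerivWithinAt
  have h3 : HasMFDerivAt 𝓘(ℝ, E) 𝓘(ℝ, ℝ) f
    ((extChartAt 𝓘(ℝ, E) x).symm (extChartAt 𝓘(ℝ, E) x y))
    (mfderiv 𝓘(ℝ, E) 𝓘(ℝ, ℝ) f ((extChartAt 𝓘(ℝ, E) x).symm (extChartAt 𝓘(ℝ, E) x y))) := by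
    rw [hys]; exact hf.hasMFDerivAt
  have h4 := h3.comp_hasMFDerivWithinAt _ h2
  rw [ModelWithCorners.range_eq_univ, hasMFDerivWithinAt_univ] at h4
  have h5 := h4.hasFDerivAt
  rw [ModelWithCorners.range_eq_univ]
  convert! h5 using 2
  rw [hys]
  rfl

omit [IsRiemannianManifold 𝓘(ℝ, E) M] in
/-- By continuity of the metric, near `x` the differential of the inverse chart increases the norm
of `T_x M` at most by any prescribed factor `r > 1`. -/
lemma eventually_norm_mfderivWithin_extChartAt_symm_le (x : M) {r : ℝ} (hr : 1 < r) :
    ∀ᶠ z in 𝓝 (extChartAt 𝓘(ℝ, E) x x), ∀ v : TangentSpace 𝓘(ℝ, E) x,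
      ‖mfderivWithin 𝓘(ℝ, E) 𝓘(ℝ, E) (extChartAt 𝓘(ℝ, E) x).symm (range 𝓘(ℝ, E)) z
        ((trivializationAt E (TangentSpace 𝓘(ℝ, E)) x).continuousLinearMapAt ℝ x v)‖
        ≤ r * ‖v‖ := by
  have h1 := eventually_norm_symmL_trivializationAt_comp_self_lt E
    (fun θ : M => TangentSpace 𝓘(ℝ, E) θ) x hr
  have h2 : (chartAt E x).source ∈ 𝓝 x := chart_source_mem_nhds E x
  have h3 : 𝓝 x = 𝓝 ((extChartAt 𝓘(ℝ, E) x).symm (extChartAt 𝓘(ℝ, E) x x)) := by simp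
  have h4 := inter_mem h1 h2
  rw [h3] at h4
  have h5 := (continuousAt_extChartAt_symm (I := 𝓘(ℝ, E)) x).preimage_mem_nhds h4
  filter_upwards [h5, extChartAt_target_mem_nhds (I := 𝓘(ℝ, E)) x] with z hz hzt v
  obtain ⟨hz1, hz2⟩ := hz
  have hz3 : extChartAt 𝓘(ℝ, E) x ((extChartAt 𝓘(ℝ, E) x).symm z) = z :=
    (extChartAt 𝓘(ℝ, E) x).right_inv hzt
  have h6 := TangentBundle.symmL_trivializationAt (I := 𝓘(ℝ, E)) hz2
  simp only [mem_ofPred_eq] at hz1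
  rw [h6] at hz1
  have h7 := ContinuousLinearMap.le_of_opNorm_le _ hz1.le v
  convert! h7 using 3
  rw [hz3]
  rfl

/-- The differential of a Lipschitz function is bounded by its Lipschitz constant with respect to
the Riemannian norm. The bound is first shown with a factor `r > 1`, lost in comparing the metric
near `x` with the metric at `x`. -/
lemma abs_scalarDifferential_le_of_lipschitzWith {f : M → ℝ} {K : ℝ≥0} (hK : LipschitzWith K f)
    {x : M} (hf : MDifferentiableAt 𝓘(ℝ, E) 𝓘(ℝ, ℝ) f x) (v : TangentSpace 𝓘(ℝ, E) x) :
    |scalarDifferential f x v| ≤ K * ‖v‖ := by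
  suffices h : ∀ r : ℝ, 1 < r →
      |scalarDifferential f x v| ≤ r * (K * ‖v‖) by
    have h1 : Tendsto (fun r : ℝ => r * (K * ‖v‖)) (𝓝[>] 1) (𝓝 (1 * (K * ‖v‖))) :=
      ((continuous_id.mul continuous_const).tendsto 1).mono_left nhdsWithin_le_nhds
    rw [one_mul] at h1
    exact ge_of_tendsto h1 (eventually_mem_nhdsWithin.mono fun r hr => h r hr)
  intro r hr
  set φ := extChartAt 𝓘(ℝ, E) x with hφ
  set w : E := (trivializationAt E (TangentSpace 𝓘(ℝ, E)) x).continuousLinearMapAt ℝ x v with hw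
  have hx : x ∈ (chartAt E x).source := mem_chart_source E x
  have hF := hasFDerivAt_comp_extChartAt_symm hx hf
  have hv : (trivializationAt E (TangentSpace 𝓘(ℝ, E)) x).symmL ℝ x w = v := by
    rw [hw]
    exact Trivialization.symmL_continuousLinearMapAt _ (by simp) v
  -- differentiate along the line of direction `w` in the chart, whose velocity at `x` is `v`
  have hline : HasDerivAt (fun t : ℝ => φ x + t • w) w 0 := by
    simpa using ((hasDerivAt_id (0 : ℝ)).smul_const w).const_add (φ x)
  have hF' : HasFDerivAt (f ∘ φ.symm) (scalarDifferential f x ∘L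
      (trivializationAt E (TangentSpace 𝓘(ℝ, E)) x).symmL ℝ x) ((fun t : ℝ => φ x + t • w) 0) := by
    simp only [zero_smul, add_zero]
    exact hF
  have hD := hF'.comp_hasDerivAt (0 : ℝ) hline
  have hD2 : HasDerivAt (fun t : ℝ => f (φ.symm (φ x + t • w)))
      (scalarDifferential f x v) 0 := by
    convert! hD using 1
    simp [hv]
  have hev := eventually_norm_mfderivWithin_extChartAt_symm_le (E := E) x hr
  obtain ⟨δ, δpos, hδ⟩ := Metric.mem_nhds_iff.1
    (inter_mem hev (extChartAt_target_mem_nhds (I := 𝓘(ℝ, E)) x))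
  have hsmall : ∀ᶠ t in 𝓝 (0 : ℝ), φ x + t • w ∈ Metric.ball (φ x) δ := by
    have : ContinuousAt (fun t : ℝ => φ x + t • w) 0 := hline.continuousAt
    apply this.preimage_mem_nhds
    simpa using Metric.ball_mem_nhds _ δpos
  rw [← Real.norm_eq_abs]
  refine HasDerivAt.le_of_lip' hD2 (by positivity) ?_
  filter_upwards [hsmall] with t ht
  have hseg : segment ℝ (φ x) (φ x + t • w) ⊆ Metric.ball (φ x) δ :=
    (convex_ball _ _).segment_subset (by simp [δpos]) ht
  have h1 : edist (φ.symm (φ x)) (φ.symm (φ x + t • w)) ≤ ENNReal.ofReal (r * ‖t • v‖) := by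
    apply edist_extChartAt_symm_le (fun z hz => (hδ (hseg hz)).2)
    intro z hz
    have h2 := (hδ (hseg hz)).1 (t • v)
    rw [← ofReal_norm]
    apply ENNReal.ofReal_le_ofReal
    convert! h2 using 3
    simp [hw]
  have h3 := hK (φ.symm (φ x)) (φ.symm (φ x + t • w))
  have h4 : edist (f (φ.symm (φ x))) (f (φ.symm (φ x + t • w)))
      ≤ ENNReal.ofReal (K * (r * ‖t • v‖)) := by
    refine h3.trans ?_
    rw [ENNReal.ofReal_mul (by positivity), ENNReal.ofReal_coe_nnreal]
    gcongr
  rw [edist_comm, edist_dist, ENNReal.ofReal_le_ofReal_iff (by positivity), dist_eq_norm] at h4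
  simp only [zero_smul, add_zero, sub_zero]
  refine h4.trans_eq ?_
  rw [norm_smul]; ring

end RiemannianGeometry

/-! ### Charts are locally bi-Lipschitz -/

section ChartEstimates

variable {E : Type*} [NormedAddCommGroup E] [NormedSpace ℝ E]
  {M : Type*} [EMetricSpace M] [ChartedSpace E M] [IsManifold 𝓘(ℝ, E) ∞ M]
  [RiemannianBundle (fun θ : M => TangentSpace 𝓘(ℝ, E) θ)]
  [IsContinuousRiemannianBundle E (fun θ : M => TangentSpace 𝓘(ℝ, E) θ)]
  [IsRiemannianManifold 𝓘(ℝ, E) M]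

lemma exists_lipschitzOnWith_extChartAt_symm (x : M) :
    ∃ C : ℝ≥0, 0 < C ∧ ∃ δ : ℝ, 0 < δ ∧
      Metric.ball (extChartAt 𝓘(ℝ, E) x x) δ ⊆ (extChartAt 𝓘(ℝ, E) x).target ∧
      LipschitzOnWith C (extChartAt 𝓘(ℝ, E) x).symm
        (Metric.ball (extChartAt 𝓘(ℝ, E) x x) δ) := by
  have hev := eventually_norm_mfderivWithin_extChartAt_symm_le (E := E) x one_lt_two
  obtain ⟨δ, δpos, hδ⟩ := Metric.mem_nhds_iff.1
    (inter_mem hev (extChartAt_target_mem_nhds (I := 𝓘(ℝ, E)) x))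
  set S : E →L[ℝ] TangentSpace 𝓘(ℝ, E) x :=
    (trivializationAt E (TangentSpace 𝓘(ℝ, E)) x).symmL ℝ x with hS
  refine ⟨2 * ‖S‖₊ + 1, by positivity, δ, δpos, fun z hz => (hδ hz).2, ?_⟩
  intro a ha b hb
  have hseg : segment ℝ a b ⊆ Metric.ball (extChartAt 𝓘(ℝ, E) x x) δ :=
    (convex_ball _ _).segment_subset ha hb
  apply edist_extChartAt_symm_le (fun z hz => (hδ (hseg hz)).2)
  intro z hz
  have h2 := (hδ (hseg hz)).1 (S (b - a))
  have h3 : (trivializationAt E (TangentSpace 𝓘(ℝ, E)) x).continuousLinearMapAt ℝ x (S (b - a))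
      = b - a := Trivialization.continuousLinearMapAt_symmL _ (by simp) _
  rw [h3] at h2
  rw [← ofReal_norm, edist_comm, edist_dist, dist_eq_norm, ← ENNReal.ofReal_coe_nnreal,
    ← ENNReal.ofReal_mul (by positivity)]
  apply ENNReal.ofReal_le_ofReal
  refine h2.trans ?_
  have h4 := S.le_opNorm (b - a)
  have h5 := norm_nonneg (b - a)
  push_cast
  nlinarith

/-- Two points near `x` are joined by an almost minimising path, which stays in the neighbourhood
where the differential of the chart is bounded. -/
lemma exists_lipschitzOnWith_extChartAt (x : M) :
    ∃ C : ℝ≥0, 0 < C ∧ ∃ δ : ℝ≥0, 0 < δ ∧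
      LipschitzOnWith C (extChartAt 𝓘(ℝ, E) x) (Metric.eball x δ) := by
  obtain ⟨C, Cpos, hC⟩ := eventually_norm_trivializationAt_lt E
    (fun θ : M => TangentSpace 𝓘(ℝ, E) θ) x
  lift C to ℝ≥0 using Cpos.le
  have hu := inter_mem hC (chart_source_mem_nhds E x)
  obtain ⟨R', R'pos, hR'⟩ := EMetric.mem_nhds_iff.1 hu
  obtain ⟨R, Rpos, hRR⟩ := ENNReal.lt_iff_exists_nnreal_btwn.1 R'pos
  have hR := (Metric.eball_subset_eball hRR.le).trans hR'
  have Rpos' : 0 < R := by exact_mod_cast Rpos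
  refine ⟨C, by exact_mod_cast Cpos, R / 3, by positivity, ?_⟩
  intro p hp q hq
  have hpq : edist p q < 2 * (R / 3 : ℝ≥0) := by
    calc edist p q ≤ edist p x + edist q x := edist_triangle_right _ _ _
      _ < (R / 3 : ℝ≥0) + (R / 3 : ℝ≥0) := ENNReal.add_lt_add hp hq
      _ = 2 * (R / 3 : ℝ≥0) := by ring
  by_contra! hlt
  have hC0 : (C : ℝ≥0∞) ≠ 0 := by exact_mod_cast Cpos.ne'
  have hlt' : edist p q < edist (extChartAt 𝓘(ℝ, E) x p) (extChartAt 𝓘(ℝ, E) x q) / C := by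
    rwa [ENNReal.lt_div_iff_mul_lt (Or.inl hC0) (Or.inl ENNReal.coe_ne_top), mul_comm]
  have hr := lt_min hlt' hpq
  rw [IsRiemannianManifold.out (I := 𝓘(ℝ, E))] at hr
  obtain ⟨γ, hγ0, hγ1, hγs, hγl⟩ := exists_lt_of_riemannianEDist_lt hr
  -- the path stays in the neighbourhood where the differential of the chart is controlled
  have hstay : ∀ t ∈ Icc (0 : ℝ) 1, ‖(trivializationAt E
      (fun θ : M => TangentSpace 𝓘(ℝ, E) θ) x).continuousLinearMapAt ℝ (γ t)‖ < C ∧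
      γ t ∈ (chartAt E x).source := by
    intro t ht
    apply hR
    have h1 : edist p (γ t) ≤ pathELength 𝓘(ℝ, E) γ 0 t := by
      rw [IsRiemannianManifold.out (I := 𝓘(ℝ, E))]
      exact riemannianEDist_le_pathELength (hγs.mono (Icc_subset_Icc le_rfl ht.2)) hγ0 rfl ht.1
    have h2 : edist p (γ t) < 2 * (R / 3 : ℝ≥0) :=
      (h1.trans (pathELength_mono le_rfl ht.2)).trans_lt (hγl.trans_le (min_le_right _ _))
    calc edist (γ t) x ≤ edist (γ t) p + edist p x := edist_triangle _ _ _
      _ < 2 * (R / 3 : ℝ≥0) + (R / 3 : ℝ≥0) := by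
          rw [edist_comm (γ t) p]
          exact ENNReal.add_lt_add h2 hp
      _ = R := by
          norm_cast
          rw [← NNReal.coe_inj]
          push_cast
          ring
  -- the length of the path in the chart is at most `C` times its Riemannian length
  set γ' := extChartAt 𝓘(ℝ, E) x ∘ γ with hγ'
  have hs : CMDiff[Icc 0 1] 1 γ' :=
    contMDiffOn_extChartAt.comp (I' := 𝓘(ℝ, E)) (t := (chartAt E x).source) hγs
      (fun t ht => (hstay t ht).2)
  have hfin : edist (extChartAt 𝓘(ℝ, E) x p) (extChartAt 𝓘(ℝ, E) x q)
      ≤ C * pathELength 𝓘(ℝ, E) γ 0 1 := by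
    calc edist (extChartAt 𝓘(ℝ, E) x p) (extChartAt 𝓘(ℝ, E) x q)
      _ = ‖γ' 1 - γ' 0‖ₑ := by
          rw [edist_comm, edist_eq_enorm_sub, hγ', Function.comp_apply, Function.comp_apply,
            hγ0, hγ1]
      _ ≤ ∫⁻ t in Icc 0 1, ‖derivWithin γ' (Icc 0 1) t‖ₑ := by
          apply enorm_sub_le_lintegral_derivWithin_Icc_of_contDiffOn_Icc _ zero_le_one
          rwa [← contMDiffOn_iff_contDiffOn]
      _ ≤ ∫⁻ t in Icc 0 1, C * ‖mfderiv[Icc 0 1] γ t 1‖ₑ := by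
          apply setLIntegral_mono' measurableSet_Icc (fun t ht => ?_)
          have h1 : mfderiv[Icc 0 1] γ' t =
              (mfderiv% (extChartAt 𝓘(ℝ, E) x) (γ t)) ∘L (mfderiv[Icc 0 1] γ t) := by
            apply mfderiv_comp_mfderivWithin
            · exact mdifferentiableAt_extChartAt (hstay t ht).2
            · exact hγs.mdifferentiableOn one_ne_zero _ ht
            · rw [uniqueMDiffWithinAt_iff_uniqueDiffWithinAt]
              exact uniqueDiffOn_Icc zero_lt_one _ ht
          have h2 : derivWithin γ' (Icc 0 1) t = (trivializationAt E
              (TangentSpace 𝓘(ℝ, E)) x).continuousLinearMapAt ℝ (γ t)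
                (mfderiv[Icc 0 1] γ t 1) := by
            rw [TangentBundle.continuousLinearMapAt_trivializationAt (hstay t ht).2,
              ← fderivWithin_derivWithin, ← mfderivWithin_eq_fderivWithin]
            exact congr($h1 1)
          rw [h2]
          refine (ContinuousLinearMap.le_opENorm _ _).trans ?_
          gcongr
          have h3 := (hstay t ht).1.le
          simp only [enorm, nnnorm]
          exact_mod_cast h3
      _ = C * pathELength 𝓘(ℝ, E) γ 0 1 := by
          rw [lintegral_const_mul' _ _ ENNReal.coe_ne_top,
            pathELength_eq_lintegral_mfderivWithin_Icc]
  have h1 : C * pathELength 𝓘(ℝ, E) γ 0 1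
      < C * (edist (extChartAt 𝓘(ℝ, E) x p) (extChartAt 𝓘(ℝ, E) x q) / C) := by
    have := hγl.trans_le (min_le_left _ _)
    gcongr
    exact ENNReal.coe_ne_top
  rw [ENNReal.mul_div_cancel hC0 ENNReal.coe_ne_top] at h1
  exact absurd (hfin.trans_lt h1) (lt_irrefl _)

end ChartEstimates

/-! ### Volume of small balls -/

section Volume

variable {d : ℕ} {M : Type*} [EMetricSpace M] [MeasurableSpace M] [BorelSpace M]
  [ChartedSpace (EuclideanSpace ℝ (Fin d)) M]
  [IsManifold 𝓘(ℝ, EuclideanSpace ℝ (Fin d)) ∞ M]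
  [RiemannianBundle (fun θ : M => TangentSpace 𝓘(ℝ, EuclideanSpace ℝ (Fin d)) θ)]
  [IsContinuousRiemannianBundle (EuclideanSpace ℝ (Fin d))
    (fun θ : M => TangentSpace 𝓘(ℝ, EuclideanSpace ℝ (Fin d)) θ)]
  [IsRiemannianManifold 𝓘(ℝ, EuclideanSpace ℝ (Fin d)) M]

lemma euclideanHausdorffMeasure_image_le {X Y : Type*} [EMetricSpace X] [MeasurableSpace X]
    [BorelSpace X] [EMetricSpace Y] [MeasurableSpace Y] [BorelSpace Y] {f : X → Y} {K : ℝ≥0}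
    {s : Set X} (hf : LipschitzOnWith K f s) (n : ℕ) :
    (μHE[n] : Measure Y) (f '' s) ≤ (K : ℝ≥0∞) ^ n * (μHE[n] : Measure X) s := by
  have h := hf.hausdorffMeasure_image_le (d := n) (by positivity)
  rw [ENNReal.rpow_natCast] at h
  rw [Measure.euclideanHausdorffMeasure_def, Measure.euclideanHausdorffMeasure_def,
    Measure.smul_apply, Measure.smul_apply, mul_smul_comm]
  gcongr

/-- The image in the chart of a ball of radius `r` contains a Euclidean ball of radius `r / C`, as
the inverse chart is `C`-Lipschitz; as the chart is `K`-Lipschitz, it increases the `d`-dimensional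
measure at most by the factor `K ^ d`. -/
lemma eventually_measure_eball_ge (x : M) :
    ∃ c : ℝ, 0 < c ∧ ∃ r₀ : ℝ, 0 < r₀ ∧ ∀ᶠ y in 𝓝 x, ∀ r, 0 < r → r ≤ r₀ →
      ENNReal.ofReal (c * r ^ d) ≤ (μHE[d] : Measure M) (Metric.eball y (ENNReal.ofReal r)) := by
  set φ := extChartAt 𝓘(ℝ, EuclideanSpace ℝ (Fin d)) x with hφ
  obtain ⟨C, Cpos, δ, δpos, hδt, hδ⟩ :=
    exists_lipschitzOnWith_extChartAt_symm (E := EuclideanSpace ℝ (Fin d)) x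
  obtain ⟨K, Kpos, η, ηpos, hη⟩ :=
    exists_lipschitzOnWith_extChartAt (E := EuclideanSpace ℝ (Fin d)) x
  set b : ℝ := (volume (Metric.ball (0 : EuclideanSpace ℝ (Fin d)) 1)).toReal with hb
  have hbfin : volume (Metric.ball (0 : EuclideanSpace ℝ (Fin d)) 1) ≠ ⊤ :=
    measure_ball_lt_top.ne
  have bpos : 0 < b := ENNReal.toReal_pos (Metric.measure_ball_pos _ _ one_pos).ne' hbfin
  have Kpos' : (0 : ℝ) < K := by exact_mod_cast Kpos
  have Cpos' : (0 : ℝ) < C := by exact_mod_cast Cpos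
  refine ⟨b / (K * C) ^ d, by positivity, min (η / 2) (C * (δ / 2)), by positivity, ?_⟩
  have hy1 : Metric.eball x (ENNReal.ofReal (η / 2)) ∈ 𝓝 x :=
    Metric.eball_mem_nhds _ (by simpa using ηpos)
  have hy2 : φ ⁻¹' Metric.ball (φ x) (δ / 2) ∈ 𝓝 x :=
    (continuousAt_extChartAt x).preimage_mem_nhds (Metric.ball_mem_nhds _ (by positivity))
  filter_upwards [hy1, hy2, extChartAt_source_mem_nhds (I := 𝓘(ℝ, EuclideanSpace ℝ (Fin d))) x]
    with y hy1 hy2 hy3 r hr hr0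
  set ρ := r / C with hρ
  have hρpos : 0 < ρ := by positivity
  have hρ' : ρ ≤ δ / 2 := by
    rw [hρ, div_le_iff₀ Cpos', mul_comm]
    exact hr0.trans (min_le_right _ _)
  have hbs : Metric.ball (φ y) ρ ⊆ Metric.ball (φ x) δ := by
    apply Metric.ball_subset_ball'
    have := Metric.mem_ball.1 hy2
    linarith
  have hsub : Metric.ball (φ y) ρ ⊆ φ '' (Metric.eball y (ENNReal.ofReal r)) := by
    intro z hz
    refine ⟨φ.symm z, ?_, φ.right_inv (hδt (hbs hz))⟩
    have h1 := hδ (hbs hz) (hbs (Metric.mem_ball_self hρpos))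
    rw [φ.left_inv hy3] at h1
    refine h1.trans_lt ?_
    have h2 : edist z (φ y) < ENNReal.ofReal ρ := by
      rw [edist_lt_ofReal]; exact hz
    calc (C : ℝ≥0∞) * edist z (φ y) < C * ENNReal.ofReal ρ := by
          gcongr
          simp
      _ = ENNReal.ofReal r := by
          rw [← ENNReal.ofReal_coe_nnreal, ← ENNReal.ofReal_mul (by positivity), hρ]
          congr 1
          field_simp
  have hsub2 : Metric.eball y (ENNReal.ofReal r) ⊆ Metric.eball x η := by
    intro z hz
    have h1 : edist z y < ENNReal.ofReal (η / 2) :=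
      (Metric.mem_eball.1 hz).trans_le (ENNReal.ofReal_le_ofReal (hr0.trans (min_le_left _ _)))
    calc edist z x ≤ edist z y + edist y x := edist_triangle _ _ _
      _ < ENNReal.ofReal (η / 2) + ENNReal.ofReal (η / 2) := ENNReal.add_lt_add h1 hy1
      _ = η := by
        rw [← ENNReal.ofReal_add (by positivity) (by positivity), add_halves,
          ENNReal.ofReal_coe_nnreal]
  have h1 := (measure_mono hsub).trans (euclideanHausdorffMeasure_image_le (hη.mono hsub2) d)
  rw [EuclideanSpace.euclideanHausdorffMeasure_eq_volume, Measure.addHaar_ball_of_pos _ _ hρpos,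
    finrank_euclideanSpace_fin, ← ENNReal.ofReal_toReal hbfin,
    ← ENNReal.ofReal_mul (by positivity)] at h1
  have h2 : b / (K * C) ^ d * r ^ d = (ρ ^ d * b) / K ^ d := by
    rw [hρ, mul_pow, div_pow]
    field_simp
  rw [h2, ENNReal.ofReal_div_of_pos (by positivity), ENNReal.ofReal_pow (by positivity),
    ENNReal.ofReal_coe_nnreal]
  exact ENNReal.div_le_of_le_mul' h1

/-- On a compact Riemannian manifold, balls of radius `r ≤ R` have volume at least `c r ^ d`. -/
lemma exists_measure_eball_ge [CompactSpace M] (R : ℝ) (hR : 0 < R) :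
    ∃ c : ℝ, 0 < c ∧ ∀ (x : M) (r : ℝ), 0 < r → r ≤ R →
      ENNReal.ofReal (c * r ^ d) ≤ (μHE[d] : Measure M) (Metric.eball x (ENNReal.ofReal r)) := by
  obtain ⟨c, cpos, r₀, r₀pos, h⟩ : ∃ c : ℝ, 0 < c ∧ ∃ r₀ : ℝ, 0 < r₀ ∧ ∀ y ∈ (univ : Set M), ∀ r,
      0 < r → r ≤ r₀ → ENNReal.ofReal (c * r ^ d) ≤
        (μHE[d] : Measure M) (Metric.eball y (ENNReal.ofReal r)) := by
    refine isCompact_univ.induction_on (p := fun s => ∃ c : ℝ, 0 < c ∧ ∃ r₀ : ℝ, 0 < r₀ ∧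
      ∀ y ∈ s, ∀ r, 0 < r → r ≤ r₀ → ENNReal.ofReal (c * r ^ d) ≤
        (μHE[d] : Measure M) (Metric.eball y (ENNReal.ofReal r))) ?_ ?_ ?_ ?_
    · exact ⟨1, one_pos, 1, one_pos, by simp⟩
    · rintro s t hst ⟨c, hc, r, hr, h⟩
      exact ⟨c, hc, r, hr, fun y hy => h y (hst hy)⟩
    · rintro s t ⟨c, hc, r, hr, h⟩ ⟨c', hc', r', hr', h'⟩
      refine ⟨min c c', lt_min hc hc', min r r', lt_min hr hr', ?_⟩
      rintro y (hy | hy) ρ hρ hρr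
      · refine le_trans ?_ (h y hy ρ hρ (hρr.trans (min_le_left _ _)))
        gcongr
        exact min_le_left _ _
      · refine le_trans ?_ (h' y hy ρ hρ (hρr.trans (min_le_right _ _)))
        gcongr
        exact min_le_right _ _
    · intro x _
      obtain ⟨c, hc, r, hr, h⟩ := eventually_measure_eball_ge (d := d) x
      exact ⟨_, mem_nhdsWithin_of_mem_nhds h, c, hc, r, hr, fun y hy => hy⟩
  -- radii between `r₀` and `R` are handled by shrinking them by the factor `l`
  set l := min 1 (r₀ / R) with hl
  have lpos : 0 < l := by positivity
  refine ⟨c * l ^ d, by positivity, fun x r hr hrR => ?_⟩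
  have h1 : l * r ≤ r₀ := by
    calc l * r ≤ (r₀ / R) * R := by gcongr; exact min_le_right _ _
      _ = r₀ := by field_simp
  have h2 := h x (mem_univ _) (l * r) (by positivity) h1
  rw [mul_pow, ← mul_assoc] at h2
  refine h2.trans (measure_mono (Metric.eball_subset_eball (ENNReal.ofReal_le_ofReal ?_)))
  exact mul_le_of_le_one_left hr.le (min_le_left _ _)

end Volume

/-! ### Continuity of gradient pairings -/

section GradientPairing

variable {E : Type*} [NormedAddCommGroup E] [NormedSpace ℝ E]
  {M : Type*} [EMetricSpace M] [ChartedSpace E M] [IsManifold 𝓘(ℝ, E) ∞ M]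

lemma ContMDiff.contDiffOn_comp_extChartAt_symm {f : M → ℝ}
    (hf : ContMDiff 𝓘(ℝ, E) 𝓘(ℝ, ℝ) 1 f) (x : M) :
    ContDiffOn ℝ 1 (f ∘ (extChartAt 𝓘(ℝ, E) x).symm) (extChartAt 𝓘(ℝ, E) x).target := by
  rw [← contMDiffOn_iff_contDiffOn]
  exact hf.comp_contMDiffOn ((contMDiffOn_extChartAt_symm x))

/-- In a chart, the coefficients of the differential of a `C¹` function are continuous. -/
lemma ContMDiff.continuousAt_scalarDifferential_symmL {f : M → ℝ}
    (hf : ContMDiff 𝓘(ℝ, E) 𝓘(ℝ, ℝ) 1 f) (x : M) :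
    ContinuousAt (fun y => (scalarDifferential f y ∘L
      (trivializationAt E (TangentSpace 𝓘(ℝ, E)) x).symmL ℝ y : E →L[ℝ] ℝ)) x := by
  have h1 := hf.contDiffOn_comp_extChartAt_symm x
  have h2 := h1.continuousOn_fderiv_of_isOpen (isOpen_extChartAt_target x) le_rfl
  have h3 : ContinuousAt (fun y => fderiv ℝ (f ∘ (extChartAt 𝓘(ℝ, E) x).symm)
      (extChartAt 𝓘(ℝ, E) x y)) x :=
    ContinuousAt.comp (g := fderiv ℝ (f ∘ (extChartAt 𝓘(ℝ, E) x).symm))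
      (h2.continuousAt (extChartAt_target_mem_nhds x)) (continuousAt_extChartAt x)
  refine h3.congr ?_
  filter_upwards [chart_source_mem_nhds E x] with y hy
  exact (hasFDerivAt_comp_extChartAt_symm hy (hf.mdifferentiable one_ne_zero y)).fderiv

variable [FiniteDimensional ℝ E]
  [RiemannianBundle (fun θ : M => TangentSpace 𝓘(ℝ, E) θ)]
  [IsContinuousRiemannianBundle E (fun θ : M => TangentSpace 𝓘(ℝ, E) θ)]

/-- The Gram form of the metric at `y`, read in the trivialization at `x`. -/
def gramForm (x y : M) : E →L[ℝ] E →L[ℝ] ℝ :=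
  let S : E →L[ℝ] TangentSpace 𝓘(ℝ, E) y := (trivializationAt E (TangentSpace 𝓘(ℝ, E)) x).symmL ℝ y
  (innerSL ℝ (E := TangentSpace 𝓘(ℝ, E) y)).bilinearComp S S

omit [FiniteDimensional ℝ E]
  [IsContinuousRiemannianBundle E (fun θ : M => TangentSpace 𝓘(ℝ, E) θ)] in
lemma gramForm_apply (x y : M) (u w : E) :
    gramForm x y u w = inner ℝ
      ((trivializationAt E (TangentSpace 𝓘(ℝ, E)) x).symmL ℝ y u : TangentSpace 𝓘(ℝ, E) y)
      ((trivializationAt E (TangentSpace 𝓘(ℝ, E)) x).symmL ℝ y w : TangentSpace 𝓘(ℝ, E) y) := rfl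

lemma continuousAt_gramForm (x : M) : ContinuousAt (fun y : M => gramForm (E := E) x y) x := by
  have hb : (trivializationAt E (TangentSpace 𝓘(ℝ, E)) x).baseSet ∈ 𝓝 x :=
    (trivializationAt E (TangentSpace 𝓘(ℝ, E)) x).open_baseSet.mem_nhds (by simp)
  suffices h : ContinuousOn (fun y : M => gramForm (E := E) x y)
      (trivializationAt E (TangentSpace 𝓘(ℝ, E)) x).baseSet from h.continuousAt hb
  rw [continuousOn_clm_apply]
  intro u
  rw [continuousOn_clm_apply]
  intro w
  have hsec : ∀ u : E, ContinuousOn (fun y : M => (⟨y,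
      (trivializationAt E (TangentSpace 𝓘(ℝ, E)) x).symmL ℝ y u⟩ :
        TotalSpace E (TangentSpace 𝓘(ℝ, E) : M → Type _)))
      (trivializationAt E (TangentSpace 𝓘(ℝ, E)) x).baseSet := by
    intro u
    have h1 : ContinuousOn (fun y : M =>
        (trivializationAt E (TangentSpace 𝓘(ℝ, E)) x).toOpenPartialHomeomorph.symm (y, u))
        (trivializationAt E (TangentSpace 𝓘(ℝ, E)) x).baseSet :=
      (trivializationAt E (TangentSpace 𝓘(ℝ, E)) x).toOpenPartialHomeomorph.symm.continuousOn.comp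
        (by fun_prop) fun y hy => (Trivialization.mem_target _).2 hy
    refine h1.congr fun y hy => ?_
    rw [Trivialization.symmL_apply _ hy]
    exact Trivialization.mk_symm _ hy u
  exact (hsec u).inner_bundle (hsec w)

/-- The pairing `⟪∇f, ∇g⟫ = df(∇g)` is continuous, where `X = ∇g` is any vector field representing
`dg`. In a chart at `x`, the coordinates of `X y` are `(gramForm x y)⁻¹ (dg)`, which depend
continuously on `y`. -/
lemma continuous_inner_of_representing {f g : M → ℝ} (hf : ContMDiff 𝓘(ℝ, E) 𝓘(ℝ, ℝ) 1 f)
    (hg : ContMDiff 𝓘(ℝ, E) 𝓘(ℝ, ℝ) 1 g) (X : ∀ y : M, TangentSpace 𝓘(ℝ, E) y)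
    (hX : ∀ y v, inner ℝ (X y) v = scalarDifferential g y v) :
    Continuous (fun y => scalarDifferential f y (X y)) := by
  rw [continuous_iff_continuousAt]
  intro x
  have hinj : ∀ y ∈ (chartAt E x).source, ∃ e : E ≃L[ℝ] (E →L[ℝ] ℝ),
      (e : E →L[ℝ] (E →L[ℝ] ℝ)) = gramForm x y := by
    intro y hy
    have hker : LinearMap.ker (gramForm (E := E) x y : E →ₗ[ℝ] (E →L[ℝ] ℝ)) = ⊥ := by
      rw [LinearMap.ker_eq_bot']
      intro u hu
      have h1 : gramForm x y u u = 0 := by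
        have : gramForm (E := E) x y u = 0 := hu
        rw [this]; rfl
      rw [gramForm_apply, inner_self_eq_zero] at h1
      have h2 := Trivialization.continuousLinearMapAt_symmL (R := ℝ)
        (trivializationAt E (TangentSpace 𝓘(ℝ, E)) x) (b := y) (by simpa using hy) u
      rw [h1, map_zero] at h2
      exact h2.symm
    have hdim : Module.finrank ℝ E = Module.finrank ℝ (E →L[ℝ] ℝ) := by
      rw [LinearMap.toContinuousLinearMap (𝕜 := ℝ) (E := E) (F' := ℝ) |>.finrank_eq.symm]
      exact Subspace.dual_finrank_eq.symm
    refine ⟨(LinearEquiv.ofInjectiveOfFinrankEq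
      (gramForm (E := E) x y : E →ₗ[ℝ] (E →L[ℝ] ℝ)) (LinearMap.ker_eq_bot.1 hker)
      hdim).toContinuousLinearEquiv, ?_⟩
    ext u w
    rfl
  have hcoord : ∀ y ∈ (chartAt E x).source, ((gramForm (E := E) x y).inverse
      (scalarDifferential g y ∘L (trivializationAt E (TangentSpace 𝓘(ℝ, E)) x).symmL ℝ y) : E) =
      (trivializationAt E (TangentSpace 𝓘(ℝ, E)) x).continuousLinearMapAt ℝ y (X y) := by
    intro y hy
    obtain ⟨e, he⟩ := hinj y hy
    rw [← he, ContinuousLinearMap.inverse_equiv]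
    change e.symm _ = _
    rw [ContinuousLinearEquiv.symm_apply_eq]
    ext w
    have h1 : e = gramForm (E := E) x y := he
    change _ = (e : E →L[ℝ] (E →L[ℝ] ℝ)) _ w
    rw [he, gramForm_apply, Trivialization.symmL_continuousLinearMapAt _ (by simpa using hy), hX]
    rfl
  obtain ⟨e, he⟩ := hinj x (mem_chart_source E x)
  have hinv : ContinuousAt (fun y : M => (gramForm (E := E) x y).inverse) x := by
    have h1 : ContinuousAt (ContinuousLinearMap.inverse (R := ℝ) (M := E) (M₂ := E →L[ℝ] ℝ))
        (gramForm x x) := by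
      rw [← he]
      exact (contDiffAt_map_inverse (n := 0) e).continuousAt
    exact h1.comp (continuousAt_gramForm x)
  have hfin := (hf.continuousAt_scalarDifferential_symmL x).clm_apply
    (hinv.clm_apply (hg.continuousAt_scalarDifferential_symmL x))
  refine hfin.congr ?_
  filter_upwards [chart_source_mem_nhds E x] with y hy
  rw [hcoord y hy]
  exact congrArg (scalarDifferential f y)
    (Trivialization.symmL_continuousLinearMapAt _ (by simpa using hy) (X y))

end GradientPairing

/-! ### Averages of Lipschitz `C¹` functions -/

section ParametricIntegral

variable {Ω : Type*} [MeasurableSpace Ω]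

/-- Derivatives depend measurably on a parameter, being limits of difference quotients. -/
lemma measurable_hasFDerivAt_apply {E : Type*} [NormedAddCommGroup E] [NormedSpace ℝ E]
    {F : Ω → E → ℝ} {F' : Ω → E →L[ℝ] ℝ} {u : E} (hF : ∀ ξ, HasFDerivAt (F ξ) (F' ξ) u)
    (hmeas : ∀ᶠ z in 𝓝 u, Measurable fun ξ => F ξ z) (w : E) : Measurable fun ξ => F' ξ w := by
  have hc : Tendsto (fun n : ℕ => ‖(n : ℝ)‖) atTop atTop := by
    simpa using tendsto_natCast_atTop_atTop (R := ℝ)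
  have hz : Tendsto (fun n : ℕ => u + (n : ℝ)⁻¹ • w) atTop (𝓝 u) := by
    have := (tendsto_inv_atTop_nhds_zero_nat (𝕜 := ℝ)).smul_const w
    simpa using this.const_add u
  obtain ⟨n₀, hn₀⟩ := eventually_atTop.1 (hz.eventually hmeas)
  refine measurable_of_tendsto_metrizable
    (f := fun n ξ => ((n + n₀ : ℕ) : ℝ) • (F ξ (u + ((n + n₀ : ℕ) : ℝ)⁻¹ • w) - F ξ u)) ?_ ?_
  · intro n
    simp only [smul_eq_mul]
    exact ((hn₀ _ (Nat.le_add_left _ _)).sub hmeas.self_of_nhds).const_mul _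
  · rw [tendsto_pi_nhds]
    intro ξ
    exact (tendsto_add_atTop_iff_nat (f := fun n : ℕ => (n : ℝ) • (F ξ (u + (n : ℝ)⁻¹ • w) - F ξ u))
      n₀).2 ((hF ξ).lim w hc)

lemma stronglyMeasurable_of_apply {E : Type*} [NormedAddCommGroup E] [NormedSpace ℝ E]
    [FiniteDimensional ℝ E] {L : Ω → E →L[ℝ] ℝ} (hL : ∀ w, Measurable fun ξ => L ξ w) :
    StronglyMeasurable L := by
  set b := Module.finBasis ℝ E
  have h : L = fun ξ => ∑ i, L ξ (b i) • (LinearMap.toContinuousLinearMap (b.coord i)) := by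
    funext ξ
    ext w
    conv_lhs => rw [← b.sum_repr w, map_sum]
    simp [-Module.Basis.sum_repr, mul_comm]
  rw [h]
  exact Finset.stronglyMeasurable_fun_sum _ fun i _ => (hL _).stronglyMeasurable.smul_const _

lemma lipschitzWith_integral {X : Type*} [PseudoEMetricSpace X] (m : Measure Ω)
    [IsFiniteMeasure m] {f : Ω → X → ℝ} {K : ℝ≥0} {U : ℝ} (hLip : ∀ ξ, LipschitzWith K (f ξ))
    (hmeas : ∀ x, Measurable fun ξ => f ξ x) (hbdd : ∀ ξ x, |f ξ x| ≤ U) :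
    LipschitzWith ((m univ).toNNReal * K) fun x => ∫ ξ, f ξ x ∂m := by
  have hint : ∀ x, Integrable (fun ξ => f ξ x) m := fun x =>
    Integrable.of_bound (hmeas x).aestronglyMeasurable U (Eventually.of_forall fun ξ => hbdd ξ x)
  intro x y
  rw [edist_eq_enorm_sub, ← integral_sub (hint x) (hint y)]
  refine (enorm_integral_le_lintegral_enorm _).trans ?_
  calc ∫⁻ ξ, ‖f ξ x - f ξ y‖ₑ ∂m ≤ ∫⁻ _, K * edist x y ∂m := by
        gcongr with ξ
        rw [← edist_eq_enorm_sub]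
        exact hLip ξ x y
    _ = _ := by
        rw [lintegral_const, ENNReal.coe_mul, ENNReal.coe_toNNReal (measure_ne_top _ _)]
        ring

variable {E : Type*} [NormedAddCommGroup E] [NormedSpace ℝ E] [FiniteDimensional ℝ E]
  {M : Type*} [EMetricSpace M] [ChartedSpace E M] [IsManifold 𝓘(ℝ, E) ∞ M]
  [RiemannianBundle (fun θ : M => TangentSpace 𝓘(ℝ, E) θ)]
  [IsContinuousRiemannianBundle E (fun θ : M => TangentSpace 𝓘(ℝ, E) θ)]
  [IsRiemannianManifold 𝓘(ℝ, E) M]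

/-- The average of a family of `C¹` functions is `C¹` as soon as the family is uniformly Lipschitz:
the differentials need not depend continuously on the parameter. -/
lemma contMDiff_integral (m : Measure Ω) [IsFiniteMeasure m] {f : Ω → M → ℝ} {K : ℝ≥0} {U : ℝ}
    (hf : ∀ ξ, ContMDiff 𝓘(ℝ, E) 𝓘(ℝ, ℝ) 1 (f ξ)) (hLip : ∀ ξ, LipschitzWith K (f ξ))
    (hmeas : ∀ x, Measurable fun ξ => f ξ x) (hbdd : ∀ ξ x, |f ξ x| ≤ U) :
    ContMDiff 𝓘(ℝ, E) 𝓘(ℝ, ℝ) 1 fun x => ∫ ξ, f ξ x ∂m := by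
  intro x
  rw [contMDiffAt_iff_source, ModelWithCorners.range_eq_univ, contMDiffWithinAt_univ,
    contMDiffAt_iff_contDiffAt, contDiffAt_one_iff]
  set φ := extChartAt 𝓘(ℝ, E) x with hφ
  obtain ⟨C, Cpos, δ, δpos, hδt, hδ⟩ := exists_lipschitzOnWith_extChartAt_symm (E := E) x
  have hopen : IsOpen (Metric.ball (φ x) δ) := Metric.isOpen_ball
  have hsm : ∀ ξ, ContDiffOn ℝ 1 (f ξ ∘ φ.symm) (Metric.ball (φ x) δ) := fun ξ =>
    ((hf ξ).contDiffOn_comp_extChartAt_symm x).mono hδt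
  have hlip : ∀ ξ, LipschitzOnWith (K * C) (f ξ ∘ φ.symm) (Metric.ball (φ x) δ) := fun ξ =>
    (hLip ξ).comp_lipschitzOnWith hδ
  have hder : ∀ z ∈ Metric.ball (φ x) δ, ∀ ξ,
      HasFDerivAt (f ξ ∘ φ.symm) (fderiv ℝ (f ξ ∘ φ.symm) z) z := fun z hz ξ =>
    (((hsm ξ).differentiableOn one_ne_zero).differentiableAt (hopen.mem_nhds hz)).hasFDerivAt
  have hdm : ∀ z ∈ Metric.ball (φ x) δ,
      AEStronglyMeasurable (fun ξ => fderiv ℝ (f ξ ∘ φ.symm) z) m := fun z hz =>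
    (stronglyMeasurable_of_apply fun w => measurable_hasFDerivAt_apply (hder z hz)
      (Eventually.of_forall fun z => hmeas (φ.symm z)) w).aestronglyMeasurable
  refine ⟨fun z => ∫ ξ, fderiv ℝ (f ξ ∘ φ.symm) z ∂m, Metric.ball (φ x) δ,
    Metric.ball_mem_nhds _ δpos, ?_, ?_⟩
  · intro z hz
    apply ContinuousAt.continuousWithinAt
    refine continuousAt_of_dominated (bound := fun _ => ((K * C : ℝ≥0) : ℝ)) ?_ ?_
      (integrable_const _) ?_
    · filter_upwards [hopen.mem_nhds hz] with z' hz' using hdm z' hz'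
    · filter_upwards [hopen.mem_nhds hz] with z' hz'
      exact Eventually.of_forall fun ξ =>
        norm_fderiv_le_of_lipschitzOn ℝ (hopen.mem_nhds hz') (hlip ξ)
    · exact Eventually.of_forall fun ξ =>
        ((hsm ξ).continuousOn_fderiv_of_isOpen hopen le_rfl).continuousAt (hopen.mem_nhds hz)
  · intro z hz
    refine (hasFDerivAt_integral_of_dominated_loc_of_lip
      (F := fun z ξ => (f ξ ∘ φ.symm) z) (bound := fun _ => ((K * C : ℝ≥0) : ℝ))
      (hopen.mem_nhds hz) ?_ ?_ (hdm z hz) ?_ (integrable_const _)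
      (Eventually.of_forall fun ξ => hder z hz ξ)).2
    · exact Eventually.of_forall fun z => (hmeas (φ.symm z)).aestronglyMeasurable
    · exact Integrable.of_bound (hmeas (φ.symm z)).aestronglyMeasurable U
        (Eventually.of_forall fun ξ => hbdd ξ _)
    · refine Eventually.of_forall fun ξ => ?_
      have : Real.nnabs ((K * C : ℝ≥0) : ℝ) = K * C := by simp
      rw [this]
      exact hlip ξ

end ParametricIntegral

/-! ### Integration on compact spaces -/

section CompactIntegration

variable {X : Type*} [EMetricSpace X] [CompactSpace X] [MeasurableSpace X] [BorelSpace X]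

lemma secondCountableTopology_of_compact_emetric (X : Type*) [EMetricSpace X] [CompactSpace X] :
    SecondCountableTopology X := EMetric.secondCountable_of_sigmaCompact X

lemma Continuous.integrable_of_compact {f : X → ℝ} (hf : Continuous f) (m : Measure X)
    [IsFiniteMeasure m] : Integrable f m := by
  have := secondCountableTopology_of_compact_emetric X
  obtain ⟨C, hC⟩ := isCompact_univ.exists_bound_of_continuousOn hf.continuousOn
  exact Integrable.of_bound hf.aestronglyMeasurable C
    (Eventually.of_forall fun x => hC x (mem_univ x))

/-- A Carathéodory function, continuous in `x` and measurable in the parameter, is jointly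
measurable. -/
lemma measurable_uncurry_of_caratheodory {Ω : Type*} [MeasurableSpace Ω] {F : Ω → X → ℝ}
    (hc : ∀ s, Continuous (F s)) (hm : ∀ x, Measurable fun s => F s x) :
    Measurable (Function.uncurry F) := by
  have := secondCountableTopology_of_compact_emetric X
  exact (measurable_uncurry_of_continuous_of_measurable (u := fun x s => F s x) hc hm).comp
    measurable_swap

lemma measurable_integral_path {Ω X : Type*} [MeasurableSpace Ω] [MeasurableSpace X]
    {μ : Ω → Measure X} [∀ s, IsProbabilityMeasure (μ s)]
    (hμ : Measurable μ) {F : Ω → X → ℝ} (hF : Measurable (Function.uncurry F)) :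
    Measurable fun s => ∫ x, F s x ∂(μ s) := by
  let κ : ProbabilityTheory.Kernel Ω X := ⟨μ, hμ⟩
  have : ProbabilityTheory.IsMarkovKernel κ :=
    ⟨fun s => inferInstanceAs (IsProbabilityMeasure (μ s))⟩
  exact (StronglyMeasurable.integral_kernel_prod_right' (κ := κ) hF.stronglyMeasurable).measurable

end CompactIntegration

/-! ### Elementary inequalities -/

lemma lipschitzWith_of_abs_sub_le {X : Type*} [PseudoEMetricSpace X] {f g h : X → ℝ}
    {K L a b : ℝ≥0} (hf : LipschitzWith K f) (hg : LipschitzWith L g)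
    (hh : ∀ x y, |h x - h y| ≤ a * |f x - f y| + b * |g x - g y|) :
    LipschitzWith (a * K + b * L) h := by
  intro x y
  have h1 : edist (h x) (h y) ≤ a * edist (f x) (f y) + b * edist (g x) (g y) := by
    simp only [edist_dist, Real.dist_eq]
    rw [← ENNReal.ofReal_coe_nnreal, ← ENNReal.ofReal_coe_nnreal,
      ← ENNReal.ofReal_mul (by positivity), ← ENNReal.ofReal_mul (by positivity),
      ← ENNReal.ofReal_add (by positivity) (by positivity)]
    exact ENNReal.ofReal_le_ofReal (hh x y)
  refine h1.trans ?_
  push_cast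
  rw [add_mul, mul_assoc, mul_assoc]
  gcongr
  · exact hf x y
  · exact hg x y

lemma abs_exp_sub_exp_le {a b : ℝ} (ha : a ≤ 0) (hb : b ≤ 0) :
    |Real.exp a - Real.exp b| ≤ |a - b| := by
  wlog hab : a ≤ b generalizing a b
  · rw [abs_sub_comm, abs_sub_comm a b]
    exact this hb ha (le_of_not_ge hab)
  have h1 := Real.exp_le_exp.2 hab
  rw [abs_of_nonpos (by linarith), abs_of_nonpos (by linarith)]
  have h2 := Real.add_one_le_exp (a - b)
  have h3 : Real.exp a = Real.exp b * Real.exp (a - b) := by rw [← Real.exp_add]; ring_nf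
  have h4 : Real.exp b ≤ 1 := Real.exp_le_one_iff.2 hb
  have h5 := Real.exp_pos b
  nlinarith

/-- A function whose increments are bounded below by a quadratic error is nondecreasing. -/
lemma le_of_forall_sub_ge_neg_sq {h : ℝ → ℝ} {T C : ℝ} (hT : 0 ≤ T)
    (hh : ∀ s t, 0 ≤ s → s ≤ t → t ≤ T → -(C * (t - s) ^ 2) ≤ h t - h s) : h 0 ≤ h T := by
  have key : ∀ n : ℕ, -(C * T ^ 2) * (1 / ((n : ℝ) + 1)) ≤ h T - h 0 := by
    intro n
    have hn : (0 : ℝ) < n + 1 := by positivity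
    have h1 : ∑ k ∈ Finset.range (n + 1), (h (T * ((k + 1 : ℕ) : ℝ) / (n + 1))
        - h (T * (k : ℝ) / (n + 1))) = h T - h 0 := by
      rw [Finset.sum_range_sub (fun k : ℕ => h (T * (k : ℝ) / (n + 1)))]
      congr 2
      · push_cast
        field_simp
      · simp
    rw [← h1]
    have h2 : ∀ k ∈ Finset.range (n + 1), -(C * (T / (n + 1)) ^ 2) ≤
        h (T * ((k + 1 : ℕ) : ℝ) / (n + 1)) - h (T * (k : ℝ) / (n + 1)) := by
      intro k hk
      have hk' : ((k + 1 : ℕ) : ℝ) ≤ n + 1 := by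
        exact_mod_cast Nat.succ_le_of_lt (Finset.mem_range.1 hk)
      have := hh (T * (k : ℝ) / (n + 1)) (T * ((k + 1 : ℕ) : ℝ) / (n + 1)) (by positivity)
        (by gcongr; simp) (by rw [div_le_iff₀ hn]; gcongr)
      convert! this using 4
      push_cast
      ring
    refine le_trans (le_of_eq ?_) (Finset.sum_le_sum h2)
    rw [Finset.sum_const, Finset.card_range, nsmul_eq_mul]
    push_cast
    field_simp
  have hlim : Tendsto (fun n : ℕ => -(C * T ^ 2) * (1 / ((n : ℝ) + 1))) atTop (𝓝 0) := by
    simpa using (tendsto_one_div_add_atTop_nhds_zero_nat (𝕜 := ℝ)).const_mul (-(C * T ^ 2))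
  have := le_of_tendsto' hlim key
  linarith

/-! ### Riemannian gradients -/

section Gradient

variable {d : ℕ} {Θ : Type*} [EMetricSpace Θ] [ChartedSpace (EuclideanSpace ℝ (Fin d)) Θ]
  [IsManifold 𝓘(ℝ, EuclideanSpace ℝ (Fin d)) ∞ Θ]
  [RiemannianBundle (fun θ : Θ => TangentSpace 𝓘(ℝ, EuclideanSpace ℝ (Fin d)) θ)]

lemma inner_riemannianGrad (f : Θ → ℝ) (θ : Θ)
    (v : TangentSpace 𝓘(ℝ, EuclideanSpace ℝ (Fin d)) θ) :
    inner ℝ (riemannianGrad d f θ) v = scalarDifferential f θ v := by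
  have : FiniteDimensional ℝ (TangentSpace 𝓘(ℝ, EuclideanSpace ℝ (Fin d)) θ) :=
    inferInstanceAs (FiniteDimensional ℝ (EuclideanSpace ℝ (Fin d)))
  have : CompleteSpace (TangentSpace 𝓘(ℝ, EuclideanSpace ℝ (Fin d)) θ) :=
    FiniteDimensional.complete ℝ _
  unfold riemannianGrad
  exact InnerProductSpace.toDual_symm_apply

lemma inner_riemannianGrad_eq (f g : Θ → ℝ) (θ : Θ) :
    inner ℝ (riemannianGrad d f θ) (riemannianGrad d g θ) =
      scalarDifferential f θ (riemannianGrad d g θ) := inner_riemannianGrad _ _ _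

omit [IsManifold 𝓘(ℝ, EuclideanSpace ℝ (Fin d)) ∞ Θ]
  [RiemannianBundle (fun θ : Θ => TangentSpace 𝓘(ℝ, EuclideanSpace ℝ (Fin d)) θ)] in
lemma scalarDifferential_exp_neg_mul {f : Θ → ℝ} {θ : Θ}
    (hf : MDifferentiableAt 𝓘(ℝ, EuclideanSpace ℝ (Fin d)) 𝓘(ℝ, ℝ) f θ) (a : ℝ)
    (v : TangentSpace 𝓘(ℝ, EuclideanSpace ℝ (Fin d)) θ) :
    scalarDifferential (fun θ => Real.exp (-a * f θ)) θ v =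
      -a * Real.exp (-a * f θ) * scalarDifferential f θ v := by
  have h1 : HasDerivAt (fun u : ℝ => Real.exp (-a * u)) (Real.exp (-a * f θ) * (-a)) (f θ) := by
    simpa using ((hasDerivAt_id (f θ)).const_mul (-a)).exp
  have h2 := h1.hasFDerivAt.hasMFDerivAt.comp θ hf.hasMFDerivAt
  have h3 := h2.mfderiv
  have h4 : scalarDifferential (fun θ => Real.exp (-a * f θ)) θ v =
    (Real.exp (-a * f θ) * (-a)) * scalarDifferential f θ v := by
    refine (congr($h3 v)).trans ?_
    change (ContinuousLinearMap.toSpanSingleton ℝ (Real.exp (-a * f θ) * (-a)))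
      (scalarDifferential f θ v) = _
    simp [mul_comm]
  rw [h4]; ring

lemma inner_grad_exp_neg_mul {f V : Θ → ℝ} {θ : Θ}
    (hf : MDifferentiableAt 𝓘(ℝ, EuclideanSpace ℝ (Fin d)) 𝓘(ℝ, ℝ) f θ) (a : ℝ) :
    inner ℝ (riemannianGrad d V θ) (riemannianGrad d (fun θ => Real.exp (-a * f θ)) θ) =
      -a * Real.exp (-a * f θ) * inner ℝ (riemannianGrad d V θ) (riemannianGrad d f θ) := by
  rw [real_inner_comm, inner_riemannianGrad_eq, scalarDifferential_exp_neg_mul hf,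
    ← inner_riemannianGrad_eq, real_inner_comm]

variable [IsContinuousRiemannianBundle (EuclideanSpace ℝ (Fin d))
    (fun θ : Θ => TangentSpace 𝓘(ℝ, EuclideanSpace ℝ (Fin d)) θ)]

lemma continuous_inner_grad {f g : Θ → ℝ}
    (hf : ContMDiff 𝓘(ℝ, EuclideanSpace ℝ (Fin d)) 𝓘(ℝ, ℝ) 1 f)
    (hg : ContMDiff 𝓘(ℝ, EuclideanSpace ℝ (Fin d)) 𝓘(ℝ, ℝ) 1 g) :
    Continuous fun θ => inner ℝ (riemannianGrad d f θ) (riemannianGrad d g θ) := by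
  simp only [inner_riemannianGrad_eq]
  exact continuous_inner_of_representing hf hg _ fun y v => inner_riemannianGrad g y v

omit [IsContinuousRiemannianBundle (EuclideanSpace ℝ (Fin d))
    (fun θ : Θ => TangentSpace 𝓘(ℝ, EuclideanSpace ℝ (Fin d)) θ)] in
/-- The gradient of a time-dependent potential, at a fixed point, is measurable in time. -/
lemma measurable_inner_grad {Ω : Type*} [MeasurableSpace Ω] {V : Ω → Θ → ℝ}
    (hV : ∀ s, ContMDiff 𝓘(ℝ, EuclideanSpace ℝ (Fin d)) 𝓘(ℝ, ℝ) 1 (V s))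
    (hm : ∀ θ, Measurable fun s => V s θ) (θ : Θ)
    (v : TangentSpace 𝓘(ℝ, EuclideanSpace ℝ (Fin d)) θ) :
    Measurable fun s => inner ℝ (riemannianGrad d (V s) θ) v := by
  simp only [inner_riemannianGrad]
  have h := measurable_hasFDerivAt_apply (fun s => hasFDerivAt_comp_extChartAt_symm
    (mem_chart_source (EuclideanSpace ℝ (Fin d)) θ) ((hV s).mdifferentiable one_ne_zero θ))
    (Eventually.of_forall fun z => hm _)
    ((trivializationAt (EuclideanSpace ℝ (Fin d))
      (TangentSpace 𝓘(ℝ, EuclideanSpace ℝ (Fin d))) θ).continuousLinearMapAt ℝ θ v)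
  convert h using 2 with s
  exact (congrArg (scalarDifferential (V s) θ)
    (Trivialization.symmL_continuousLinearMapAt _ (by simp) v)).symm

variable [IsRiemannianManifold 𝓘(ℝ, EuclideanSpace ℝ (Fin d)) Θ]

lemma norm_riemannianGrad_le {f : Θ → ℝ} {K : ℝ≥0}
    (hf : ContMDiff 𝓘(ℝ, EuclideanSpace ℝ (Fin d)) 𝓘(ℝ, ℝ) 1 f) (hK : LipschitzWith K f) (θ : Θ) :
    ‖riemannianGrad d f θ‖ ≤ K := by
  have h1 := abs_scalarDifferential_le_of_lipschitzWith hK (hf.mdifferentiable one_ne_zero θ)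
    (riemannianGrad d f θ)
  rw [← inner_riemannianGrad, real_inner_self_eq_norm_sq, abs_of_nonneg (by positivity)] at h1
  by_contra! h
  have := K.coe_nonneg
  nlinarith

lemma abs_inner_grad_le {f g : Θ → ℝ} {K L : ℝ≥0}
    (hf : ContMDiff 𝓘(ℝ, EuclideanSpace ℝ (Fin d)) 𝓘(ℝ, ℝ) 1 f) (hK : LipschitzWith K f)
    (hg : ContMDiff 𝓘(ℝ, EuclideanSpace ℝ (Fin d)) 𝓘(ℝ, ℝ) 1 g) (hL : LipschitzWith L g) (θ : Θ) :
    |inner ℝ (riemannianGrad d f θ) (riemannianGrad d g θ)| ≤ K * L := by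
  refine (abs_real_inner_le_norm _ _).trans ?_
  gcongr
  · exact norm_riemannianGrad_le hf hK θ
  · exact norm_riemannianGrad_le hg hL θ

end Gradient

/-! ### Wasserstein–Fisher–Rao paths -/

section WFR

variable {d : ℕ} {Θ : Type*} [EMetricSpace Θ] [CompactSpace Θ] [MeasurableSpace Θ] [BorelSpace Θ]
  [ChartedSpace (EuclideanSpace ℝ (Fin d)) Θ]
  [IsManifold 𝓘(ℝ, EuclideanSpace ℝ (Fin d)) ∞ Θ]
  [RiemannianBundle (fun θ : Θ => TangentSpace 𝓘(ℝ, EuclideanSpace ℝ (Fin d)) θ)]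

/-- The rate of change of `∫ ψ dμ` along the Wasserstein–Fisher–Rao flow of the potential `V`. -/
def wfrRate (d : ℕ) {Θ : Type*} [EMetricSpace Θ] [MeasurableSpace Θ]
    [ChartedSpace (EuclideanSpace ℝ (Fin d)) Θ]
    [IsManifold 𝓘(ℝ, EuclideanSpace ℝ (Fin d)) ∞ Θ]
    [RiemannianBundle (fun θ : Θ => TangentSpace 𝓘(ℝ, EuclideanSpace ℝ (Fin d)) θ)]
    (α γ : ℝ) (V : Θ → ℝ) (m : Measure Θ) (ψ : Θ → ℝ) : ℝ :=
  -γ * ∫ θ, inner ℝ (riemannianGrad d V θ) (riemannianGrad d ψ θ) ∂m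
    - α * ∫ θ, ψ θ * (V θ - ∫ θ', V θ' ∂m) ∂m

/-- A path `μ` of probability measures solving, weakly, the Wasserstein–Fisher–Rao equation of a
time-dependent potential `V` with values in `[0, U]` that is `C¹` and `G`-Lipschitz in space and
only measurable in time. -/
structure IsWFRPath (d : ℕ) {Θ : Type*} [EMetricSpace Θ] [MeasurableSpace Θ]
    [ChartedSpace (EuclideanSpace ℝ (Fin d)) Θ]
    [IsManifold 𝓘(ℝ, EuclideanSpace ℝ (Fin d)) ∞ Θ]
    [RiemannianBundle (fun θ : Θ => TangentSpace 𝓘(ℝ, EuclideanSpace ℝ (Fin d)) θ)]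
    (α γ U : ℝ) (G : ℝ≥0) (V : ℝ → Θ → ℝ) (μ : ℝ → Measure Θ) : Prop where
  isProbabilityMeasure : ∀ s, IsProbabilityMeasure (μ s)
  measurable_path : Measurable μ
  contMDiff : ∀ s, ContMDiff 𝓘(ℝ, EuclideanSpace ℝ (Fin d)) 𝓘(ℝ, ℝ) 1 (V s)
  lipschitz : ∀ s, LipschitzWith G (V s)
  nonneg : ∀ s θ, 0 ≤ V s θ
  le_bound : ∀ s θ, V s θ ≤ U
  measurable_potential : ∀ θ, Measurable fun s => V s θ
  weak : ∀ ψ : Θ → ℝ, ContMDiff 𝓘(ℝ, EuclideanSpace ℝ (Fin d)) 𝓘(ℝ, ℝ) 1 ψ → ∀ t, 0 ≤ t →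
    ∫ θ, ψ θ ∂(μ t) = ∫ θ, ψ θ ∂(μ 0) + ∫ s in (0 : ℝ)..t, wfrRate d α γ (V s) (μ s) ψ

namespace IsWFRPath

variable {α γ U : ℝ} {G : ℝ≥0} {V : ℝ → Θ → ℝ} {μ : ℝ → Measure Θ}

omit [CompactSpace Θ] [BorelSpace Θ] in
lemma abs_potential_le (h : IsWFRPath d α γ U G V μ) (s : ℝ) (θ : Θ) : |V s θ| ≤ U := by
  rw [abs_of_nonneg (h.nonneg s θ)]; exact h.le_bound s θ

lemma measurable_uncurry (h : IsWFRPath d α γ U G V μ) : Measurable (Function.uncurry V) :=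
  measurable_uncurry_of_caratheodory (fun s => (h.lipschitz s).continuous) h.measurable_potential

lemma measurable_mean (h : IsWFRPath d α γ U G V μ) : Measurable fun s => ∫ θ, V s θ ∂(μ s) :=
  have := h.isProbabilityMeasure
  measurable_integral_path h.measurable_path h.measurable_uncurry

omit [CompactSpace Θ] [BorelSpace Θ] in
lemma mean_nonneg (h : IsWFRPath d α γ U G V μ) (s : ℝ) : 0 ≤ ∫ θ, V s θ ∂(μ s) :=
  integral_nonneg (h.nonneg s)

lemma mean_le (h : IsWFRPath d α γ U G V μ) (s : ℝ) : ∫ θ, V s θ ∂(μ s) ≤ U := by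
  have := h.isProbabilityMeasure s
  calc ∫ θ, V s θ ∂(μ s) ≤ ∫ _, U ∂(μ s) :=
        integral_mono ((h.lipschitz s).continuous.integrable_of_compact _) (integrable_const _)
          (h.le_bound s)
    _ = U := by simp

lemma nonneg_bound (h : IsWFRPath d α γ U G V μ) : 0 ≤ U :=
  (h.mean_nonneg 0).trans (h.mean_le 0)

lemma abs_sub_mean_le (h : IsWFRPath d α γ U G V μ) (s r : ℝ) (θ : Θ) :
    |V s θ - ∫ θ', V r θ' ∂(μ r)| ≤ U := by
  have h1 := h.nonneg s θ
  have h2 := h.le_bound s θ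
  have h3 := h.mean_nonneg r
  have h4 := h.mean_le r
  rw [abs_le]
  constructor <;> linarith

variable [IsContinuousRiemannianBundle (EuclideanSpace ℝ (Fin d))
    (fun θ : Θ => TangentSpace 𝓘(ℝ, EuclideanSpace ℝ (Fin d)) θ)]

lemma measurable_wfrRate (h : IsWFRPath d α γ U G V μ) {ψ : Θ → ℝ}
    (hψ : ContMDiff 𝓘(ℝ, EuclideanSpace ℝ (Fin d)) 𝓘(ℝ, ℝ) 1 ψ) :
    Measurable fun s => wfrRate d α γ (V s) (μ s) ψ := by
  have := h.isProbabilityMeasure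
  refine ((measurable_integral_path h.measurable_path ?_).const_mul _).sub
    ((measurable_integral_path h.measurable_path ?_).const_mul _)
  · exact measurable_uncurry_of_caratheodory (fun s => continuous_inner_grad (h.contMDiff s) hψ)
      fun θ => measurable_inner_grad h.contMDiff h.measurable_potential θ _
  · exact measurable_uncurry_of_caratheodory
      (fun s => hψ.continuous.mul ((h.lipschitz s).continuous.sub continuous_const))
      fun θ => ((h.measurable_potential θ).sub h.measurable_mean).const_mul _

variable [IsRiemannianManifold 𝓘(ℝ, EuclideanSpace ℝ (Fin d)) Θ]

lemma abs_wfrRate_le (h : IsWFRPath d α γ U G V μ) (hα : 0 ≤ α) (hγ : 0 ≤ γ) {ψ : Θ → ℝ}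
    {L : ℝ≥0} {B : ℝ} (hψ : ContMDiff 𝓘(ℝ, EuclideanSpace ℝ (Fin d)) 𝓘(ℝ, ℝ) 1 ψ)
    (hL : LipschitzWith L ψ) (hB : ∀ θ, |ψ θ| ≤ B) (s : ℝ) :
    |wfrRate d α γ (V s) (μ s) ψ| ≤ γ * (G * L) + α * (B * U) := by
  have := h.isProbabilityMeasure s
  have h1 : |∫ θ, inner ℝ (riemannianGrad d (V s) θ) (riemannianGrad d ψ θ) ∂(μ s)| ≤ G * L := by
    have := norm_integral_le_of_norm_le_const (μ := μ s)
      (f := fun θ => inner ℝ (riemannianGrad d (V s) θ) (riemannianGrad d ψ θ))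
      (C := (G : ℝ) * L) (Eventually.of_forall fun θ =>
        abs_inner_grad_le (h.contMDiff s) (h.lipschitz s) hψ hL θ)
    simpa using this
  have h2 : |∫ θ, ψ θ * (V s θ - ∫ θ', V s θ' ∂(μ s)) ∂(μ s)| ≤ B * U := by
    have := norm_integral_le_of_norm_le_const (μ := μ s)
      (f := fun θ => ψ θ * (V s θ - ∫ θ', V s θ' ∂(μ s))) (C := B * U)
      (Eventually.of_forall fun θ => by
        rw [Real.norm_eq_abs, abs_mul]
        exact mul_le_mul (hB θ) (h.abs_sub_mean_le s s θ) (abs_nonneg _)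
          ((abs_nonneg _).trans (hB θ)))
    simpa using this
  unfold wfrRate
  refine (abs_sub _ _).trans ?_
  rw [abs_mul, abs_mul, abs_neg, abs_of_nonneg hα, abs_of_nonneg hγ]
  gcongr

lemma intervalIntegrable_wfrRate (h : IsWFRPath d α γ U G V μ) (hα : 0 ≤ α) (hγ : 0 ≤ γ)
    {ψ : Θ → ℝ} {L : ℝ≥0} {B : ℝ} (hψ : ContMDiff 𝓘(ℝ, EuclideanSpace ℝ (Fin d)) 𝓘(ℝ, ℝ) 1 ψ)
    (hL : LipschitzWith L ψ) (hB : ∀ θ, |ψ θ| ≤ B) (s t : ℝ) :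
    IntervalIntegrable (fun r => wfrRate d α γ (V r) (μ r) ψ) volume s t :=
  intervalIntegrable_const (c := γ * (G * L) + α * (B * U)) |>.mono_fun
    (h.measurable_wfrRate hψ).aestronglyMeasurable (Eventually.of_forall fun r => by
      exact (h.abs_wfrRate_le hα hγ hψ hL hB r).trans (le_abs_self _))

/-- The weak equation on an arbitrary interval of nonnegative times. -/
lemma integral_sub_integral (h : IsWFRPath d α γ U G V μ) (hα : 0 ≤ α) (hγ : 0 ≤ γ)
    {ψ : Θ → ℝ} {L : ℝ≥0} {B : ℝ} (hψ : ContMDiff 𝓘(ℝ, EuclideanSpace ℝ (Fin d)) 𝓘(ℝ, ℝ) 1 ψ)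
    (hL : LipschitzWith L ψ) (hB : ∀ θ, |ψ θ| ≤ B) {s t : ℝ} (hs : 0 ≤ s) (ht : 0 ≤ t) :
    ∫ θ, ψ θ ∂(μ t) - ∫ θ, ψ θ ∂(μ s) = ∫ r in s..t, wfrRate d α γ (V r) (μ r) ψ := by
  have hi := h.intervalIntegrable_wfrRate hα hγ hψ hL hB
  rw [h.weak ψ hψ t ht, h.weak ψ hψ s hs, ← intervalIntegral.integral_interval_sub_left
    (hi 0 t) (hi 0 s)]
  ring

/-- Quantitative continuity in time of the path, against Lipschitz `C¹` functions. -/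
lemma abs_integral_sub_integral_le (h : IsWFRPath d α γ U G V μ) (hα : 0 ≤ α) (hγ : 0 ≤ γ)
    {ψ : Θ → ℝ} {L : ℝ≥0} {B : ℝ} (hψ : ContMDiff 𝓘(ℝ, EuclideanSpace ℝ (Fin d)) 𝓘(ℝ, ℝ) 1 ψ)
    (hL : LipschitzWith L ψ) (hB : ∀ θ, |ψ θ| ≤ B) {s t : ℝ} (hs : 0 ≤ s) (ht : 0 ≤ t) :
    |∫ θ, ψ θ ∂(μ t) - ∫ θ, ψ θ ∂(μ s)| ≤ (γ * (G * L) + α * (B * U)) * |t - s| := by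
  rw [h.integral_sub_integral hα hγ hψ hL hB hs ht]
  exact intervalIntegral.norm_integral_le_of_norm_le_const
    (f := fun r => wfrRate d α γ (V r) (μ r) ψ) fun r _ => h.abs_wfrRate_le hα hγ hψ hL hB r

end IsWFRPath

end WFR

/-! ### Monotonicity of the exponential functional -/

section WFRRegret

variable {d : ℕ} {Θ : Type*} [EMetricSpace Θ] [CompactSpace Θ] [MeasurableSpace Θ] [BorelSpace Θ]
  [ChartedSpace (EuclideanSpace ℝ (Fin d)) Θ]
  [IsManifold 𝓘(ℝ, EuclideanSpace ℝ (Fin d)) ∞ Θ]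
  [RiemannianBundle (fun θ : Θ => TangentSpace 𝓘(ℝ, EuclideanSpace ℝ (Fin d)) θ)]

/-- The function `Φ_s(θ) = ∫_s^T V_r(θ) dr + ∫_0^s ⟨V_r, μ_r⟩ dr + γ G² (T - s)² / 2`. The last
summand compensates for the transport, so that `Φ` is a supersolution of the backward equation
`-∂_s Φ + γ ⟪∇V_s, ∇Φ⟫ = V_s - ⟨V_s, μ_s⟩`. -/
def supersolution (γ : ℝ) (G : ℝ≥0) (V : ℝ → Θ → ℝ) (μ : ℝ → Measure Θ) (T s : ℝ) (θ : Θ) : ℝ :=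
  (∫ r in s..T, V r θ) + ((∫ r in (0 : ℝ)..s, ∫ θ', V r θ' ∂(μ r)) + γ * G ^ 2 * (T - s) ^ 2 / 2)

/-- The test function `ψ_s = exp(-α Φ_s)`. -/
def expTest (α γ : ℝ) (G : ℝ≥0) (V : ℝ → Θ → ℝ) (μ : ℝ → Measure Θ) (T s : ℝ) (θ : Θ) : ℝ :=
  Real.exp (-α * supersolution γ G V μ T s θ)

/-- Convexity of the exponential bounds the time increment of the test function from below. -/
lemma sub_expTest_ge {Θ : Type*} [MeasurableSpace Θ] (α γ : ℝ) (G : ℝ≥0) (V : ℝ → Θ → ℝ)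
    (μ : ℝ → Measure Θ) (T s t : ℝ) (θ : Θ) :
    α * (expTest α γ G V μ T s θ *
      (supersolution γ G V μ T s θ - supersolution γ G V μ T t θ)) ≤
      expTest α γ G V μ T t θ - expTest α γ G V μ T s θ := by
  set a := supersolution γ G V μ T s θ
  set b := supersolution γ G V μ T t θ
  have h1 : expTest α γ G V μ T t θ = expTest α γ G V μ T s θ * Real.exp (α * (a - b)) := by
    unfold expTest
    rw [← Real.exp_add]
    congr 1
    ring
  have h2 := Real.add_one_le_exp (α * (a - b))
  have h3 : 0 < expTest α γ G V μ T s θ := Real.exp_pos _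
  rw [h1]
  nlinarith [mul_le_mul_of_nonneg_left h2 h3.le]

namespace IsWFRPath

variable {α γ U T : ℝ} {G : ℝ≥0} {V : ℝ → Θ → ℝ} {μ : ℝ → Measure Θ}

omit [CompactSpace Θ] [BorelSpace Θ] in
lemma intervalIntegrable_potential (h : IsWFRPath d α γ U G V μ) (θ : Θ) (s t : ℝ) :
    IntervalIntegrable (fun r => V r θ) volume s t :=
  intervalIntegrable_const (c := U) |>.mono_fun
    (h.measurable_potential θ).aestronglyMeasurable (Eventually.of_forall fun r => by
      exact (h.abs_potential_le r θ).trans (le_abs_self _))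

lemma intervalIntegrable_mean (h : IsWFRPath d α γ U G V μ) (s t : ℝ) :
    IntervalIntegrable (fun r => ∫ θ, V r θ ∂(μ r)) volume s t :=
  intervalIntegrable_const (c := U) |>.mono_fun
    h.measurable_mean.aestronglyMeasurable (Eventually.of_forall fun r => by
      exact (abs_of_nonneg (h.mean_nonneg r)).le.trans ((h.mean_le r).trans (le_abs_self _)))

omit [CompactSpace Θ] [BorelSpace Θ] in
lemma supersolution_nonneg (h : IsWFRPath d α γ U G V μ) (hγ : 0 ≤ γ) {s : ℝ} (hs : 0 ≤ s)
    (hsT : s ≤ T) (θ : Θ) : 0 ≤ supersolution γ G V μ T s θ := by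
  have h1 : 0 ≤ ∫ r in s..T, V r θ := intervalIntegral.integral_nonneg hsT fun r _ => h.nonneg r θ
  have h2 : 0 ≤ ∫ r in (0 : ℝ)..s, ∫ θ', V r θ' ∂(μ r) :=
    intervalIntegral.integral_nonneg hs fun r _ => h.mean_nonneg r
  unfold supersolution
  positivity

omit [CompactSpace Θ] [BorelSpace Θ] in
lemma lipschitzWith_supersolution (h : IsWFRPath d α γ U G V μ) {s : ℝ} (hsT : s ≤ T) :
    LipschitzWith ((T - s).toNNReal * G) (supersolution γ G V μ T s) := by
  have h1 := lipschitzWith_integral (volume.restrict (Ioc s T)) h.lipschitz h.measurable_potential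
    h.abs_potential_le
  have h2 : (volume.restrict (Ioc s T) univ).toNNReal = (T - s).toNNReal := by simp; rfl
  rw [h2] at h1
  intro x y
  simp only [supersolution, edist_add_right]
  simp only [intervalIntegral.integral_of_le hsT]
  exact h1 x y

lemma sub_supersolution (h : IsWFRPath d α γ U G V μ) (s t : ℝ) (θ : Θ) :
    supersolution γ G V μ T s θ - supersolution γ G V μ T t θ =
      (∫ r in s..t, (V r θ - ∫ θ', V r θ' ∂(μ r)))
        + γ * G ^ 2 * ((t - s) * (T - s) - (t - s) ^ 2 / 2) := by
  rw [intervalIntegral.integral_sub (h.intervalIntegrable_potential θ s t)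
    (h.intervalIntegrable_mean s t)]
  have h1 := intervalIntegral.integral_add_adjacent_intervals
    (h.intervalIntegrable_potential θ s t) (h.intervalIntegrable_potential θ t T)
  have h2 := intervalIntegral.integral_add_adjacent_intervals
    (h.intervalIntegrable_mean 0 s) (h.intervalIntegrable_mean s t)
  unfold supersolution
  rw [← h1, ← h2]
  ring

omit [CompactSpace Θ] [BorelSpace Θ] in
lemma expTest_le_one (h : IsWFRPath d α γ U G V μ) (hα : 0 ≤ α) (hγ : 0 ≤ γ) {s : ℝ}
    (hs : 0 ≤ s) (hsT : s ≤ T) (θ : Θ) : expTest α γ G V μ T s θ ≤ 1 := by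
  have := h.supersolution_nonneg hγ hs hsT θ
  exact Real.exp_le_one_iff.2 (by nlinarith)

omit [CompactSpace Θ] [BorelSpace Θ] in
lemma abs_expTest_le_one (h : IsWFRPath d α γ U G V μ) (hα : 0 ≤ α) (hγ : 0 ≤ γ) {s : ℝ}
    (hs : 0 ≤ s) (hsT : s ≤ T) (θ : Θ) : |expTest α γ G V μ T s θ| ≤ 1 := by
  rw [abs_of_nonneg (show 0 ≤ expTest α γ G V μ T s θ from (Real.exp_pos _).le)]
  exact h.expTest_le_one hα hγ hs hsT θ

omit [CompactSpace Θ] [BorelSpace Θ] in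
lemma lipschitzWith_expTest (h : IsWFRPath d α γ U G V μ) (hα : 0 ≤ α) (hγ : 0 ≤ γ) {s : ℝ}
    (hs : 0 ≤ s) (hsT : s ≤ T) :
    LipschitzWith (α.toNNReal * (T.toNNReal * G)) (expTest α γ G V μ T s) := by
  have h1 := (h.lipschitzWith_supersolution hsT).weaken
    (K' := T.toNNReal * G) (by gcongr; linarith)
  have h2 := lipschitzWith_of_abs_sub_le (h := expTest α γ G V μ T s) (a := α.toNNReal) (b := 0)
    h1 h1 fun x y => by
      have hx := h.supersolution_nonneg hγ hs hsT x
      have hy := h.supersolution_nonneg hγ hs hsT y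
      refine (abs_exp_sub_exp_le (by nlinarith) (by nlinarith)).trans_eq ?_
      rw [← mul_sub, abs_mul, abs_neg, abs_of_nonneg hα, Real.coe_toNNReal _ hα]
      simp
  simpa using h2

variable [IsContinuousRiemannianBundle (EuclideanSpace ℝ (Fin d))
    (fun θ : Θ => TangentSpace 𝓘(ℝ, EuclideanSpace ℝ (Fin d)) θ)]
  [IsRiemannianManifold 𝓘(ℝ, EuclideanSpace ℝ (Fin d)) Θ]

omit [CompactSpace Θ] [BorelSpace Θ] in
lemma contMDiff_supersolution (h : IsWFRPath d α γ U G V μ) {s : ℝ} (hsT : s ≤ T) :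
    ContMDiff 𝓘(ℝ, EuclideanSpace ℝ (Fin d)) 𝓘(ℝ, ℝ) 1 (supersolution γ G V μ T s) := by
  have h1 := contMDiff_integral (volume.restrict (Ioc s T)) h.contMDiff h.lipschitz
    h.measurable_potential h.abs_potential_le
  unfold supersolution
  simp only [intervalIntegral.integral_of_le hsT]
  exact h1.add contMDiff_const

omit [CompactSpace Θ] [BorelSpace Θ] in
lemma contMDiff_expTest (h : IsWFRPath d α γ U G V μ) {s : ℝ} (hsT : s ≤ T) :
    ContMDiff 𝓘(ℝ, EuclideanSpace ℝ (Fin d)) 𝓘(ℝ, ℝ) 1 (expTest α γ G V μ T s) := by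
  have h1 : ContDiff ℝ 1 fun u : ℝ => Real.exp (-α * u) := by fun_prop
  exact h1.contMDiff.comp (h.contMDiff_supersolution hsT)

/-- The transport term of `wfrRate` at the test function `ψ_s` is bounded below, because
`‖∇V_r‖ ≤ G` and `‖∇Φ_s‖ ≤ G (T - s)`. -/
lemma transport_expTest_ge (h : IsWFRPath d α γ U G V μ) (hα : 0 ≤ α) (hγ : 0 ≤ γ) {s : ℝ}
    (hsT : s ≤ T) (r : ℝ) :
    -(α * γ * G ^ 2 * (T - s) * ∫ θ, expTest α γ G V μ T s θ ∂(μ r)) ≤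
      -γ * ∫ θ, inner ℝ (riemannianGrad d (V r) θ)
        (riemannianGrad d (expTest α γ G V μ T s) θ) ∂(μ r) := by
  have := h.isProbabilityMeasure r
  have hψ := h.contMDiff_expTest (γ := γ) (α := α) hsT
  have h1 : ∀ θ, inner ℝ (riemannianGrad d (V r) θ) (riemannianGrad d (expTest α γ G V μ T s) θ)
      ≤ α * G ^ 2 * (T - s) * expTest α γ G V μ T s θ := by
    intro θ
    have h2 := abs_inner_grad_le (h.contMDiff r) (h.lipschitz r)
      (h.contMDiff_supersolution hsT) (h.lipschitzWith_supersolution hsT) θ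
    have h3 := inner_grad_exp_neg_mul (V := V r) (f := supersolution γ G V μ T s) (θ := θ)
      ((h.contMDiff_supersolution hsT).mdifferentiable one_ne_zero θ) α
    have h4 := (abs_le.1 h2).1
    have h5 : (0 : ℝ) ≤ α * expTest α γ G V μ T s θ := mul_nonneg hα (Real.exp_pos _).le
    change inner ℝ (riemannianGrad d (V r) θ) (riemannianGrad d (expTest α γ G V μ T s) θ) =
      -α * expTest α γ G V μ T s θ * _ at h3
    rw [h3]
    push_cast at h4
    rw [Real.coe_toNNReal _ (by linarith)] at h4
    nlinarith [mul_le_mul_of_nonneg_left h4 h5]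
  have h2 : ∫ θ, inner ℝ (riemannianGrad d (V r) θ)
        (riemannianGrad d (expTest α γ G V μ T s) θ) ∂(μ r) ≤
      ∫ θ, α * G ^ 2 * (T - s) * expTest α γ G V μ T s θ ∂(μ r) :=
    integral_mono ((continuous_inner_grad (h.contMDiff r) hψ).integrable_of_compact _)
      ((hψ.continuous.integrable_of_compact _).const_mul _) h1
  rw [integral_const_mul] at h2
  nlinarith [mul_le_mul_of_nonneg_left h2 hγ]

/-- Along the flow `∫ ψ_s dμ_s` can only decrease by an amount quadratic in the time step. The
change of the test function is integrated against `μ_t`, the motion of the measure against `ψ_s`; to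
first order, the reaction term of the second cancels with the first, and the transport term is
absorbed by the quadratic summand of `Φ`. -/
lemma exists_integral_expTest_sub_ge (h : IsWFRPath d α γ U G V μ) (hα : 0 ≤ α) (hγ : 0 ≤ γ) :
    ∃ C : ℝ, ∀ s t, 0 ≤ s → s ≤ t → t ≤ T → -(C * (t - s) ^ 2) ≤
      ∫ θ, expTest α γ G V μ T t θ ∂(μ t) - ∫ θ, expTest α γ G V μ T s θ ∂(μ s) := by
  have := h.isProbabilityMeasure
  have hU := h.nonneg_bound
  set L : ℝ≥0 := α.toNNReal * (T.toNNReal * G) with hL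
  set C₁ : ℝ := γ * (G * (U.toNNReal * L + 1 * G : ℝ≥0)) + α * (U * U) with hC₁
  set C₂ : ℝ := γ * (G * L) + α * (1 * U) with hC₂
  have hC₂0 : 0 ≤ C₂ := by positivity
  refine ⟨α * C₁ + α * γ * G ^ 2 * T * C₂ + α * γ * G ^ 2 / 2, fun s t hs hst htT => ?_⟩
  have hsT := hst.trans htT
  have ht := hs.trans hst
  set ψ := expTest α γ G V μ T s with hψdef
  set w : ℝ → ℝ := fun r => ∫ θ, V r θ ∂(μ r) with hw
  have hψ : ContMDiff 𝓘(ℝ, EuclideanSpace ℝ (Fin d)) 𝓘(ℝ, ℝ) 1 ψ := h.contMDiff_expTest hsT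
  have hψL : LipschitzWith L ψ := h.lipschitzWith_expTest hα hγ hs hsT
  have hψ1 : ∀ θ, |ψ θ| ≤ 1 := h.abs_expTest_le_one hα hγ hs hsT
  have hψi : ∀ r, Integrable ψ (μ r) := fun r => hψ.continuous.integrable_of_compact _
  set A := ∫ θ, ψ θ ∂(μ t) with hA
  have hA1 : A ≤ 1 := by
    have := integral_mono (hψi t) (integrable_const (1 : ℝ)) fun θ => (abs_le.1 (hψ1 θ)).2
    simpa using this
  set ζ : ℝ → Θ → ℝ := fun r θ => ψ θ * (V r θ - w r) with hζ
  have hζs : ∀ r, ContMDiff 𝓘(ℝ, EuclideanSpace ℝ (Fin d)) 𝓘(ℝ, ℝ) 1 (ζ r) := fun r =>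
    hψ.mul ((h.contMDiff r).sub contMDiff_const)
  have hζU : ∀ r θ, |ζ r θ| ≤ U := fun r θ => by
    rw [hζ, abs_mul]
    exact (mul_le_mul (hψ1 θ) (h.abs_sub_mean_le r r θ) (abs_nonneg _) zero_le_one).trans_eq
      (one_mul U)
  have hζL : ∀ r, LipschitzWith (U.toNNReal * L + 1 * G) (ζ r) := fun r =>
    lipschitzWith_of_abs_sub_le hψL (h.lipschitz r) fun x y => by
      have h1 : ζ r x - ζ r y = (V r x - w r) * (ψ x - ψ y) + ψ y * (V r x - V r y) := by
        simp only [hζ]; ring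
      rw [h1, Real.coe_toNNReal _ hU]
      refine (abs_add_le _ _).trans ?_
      rw [abs_mul, abs_mul]
      gcongr
      · exact h.abs_sub_mean_le r r x
      · exact hψ1 y
  have hζm : Measurable (Function.uncurry ζ) :=
    measurable_uncurry_of_caratheodory (fun r => (hζs r).continuous) fun θ =>
      ((h.measurable_potential θ).sub h.measurable_mean).const_mul _
  set J : ℝ → ℝ := fun r => ∫ θ, ζ r θ ∂(μ t) with hJ
  have hJm : Measurable J := measurable_integral_path (μ := fun _ => μ t) measurable_const hζm
  have hJi : IntervalIntegrable J volume s t :=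
    intervalIntegrable_const (c := U) |>.mono_fun hJm.aestronglyMeasurable
      (Eventually.of_forall fun r => by
        have := norm_integral_le_of_norm_le_const (μ := μ t) (f := ζ r) (C := U)
          (Eventually.of_forall (hζU r))
        rw [probReal_univ, mul_one] at this
        exact this.trans (le_abs_self _))
  -- the contribution of the change of the test function
  have hfirst : α * (∫ r in s..t, J r)
      + α * (γ * G ^ 2 * ((t - s) * (T - s) - (t - s) ^ 2 / 2)) * A ≤
      ∫ θ, expTest α γ G V μ T t θ ∂(μ t) - A := by
    have hΦs := (h.contMDiff_supersolution (T := T) hsT).continuous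
    have hΦt := (h.contMDiff_supersolution (T := T) htT).continuous
    have hψt := (h.contMDiff_expTest (T := T) (α := α) htT).continuous
    have h1 := integral_mono (μ := μ t)
      (f := fun θ => α * (ψ θ *
        (supersolution γ G V μ T s θ - supersolution γ G V μ T t θ)))
      (g := fun θ => expTest α γ G V μ T t θ - ψ θ)
      (((hψ.continuous.mul (hΦs.sub hΦt)).integrable_of_compact (μ t)).const_mul α)
      ((hψt.sub hψ.continuous).integrable_of_compact (μ t))
      fun θ => sub_expTest_ge α γ G V μ T s t θ
    rw [integral_sub (hψt.integrable_of_compact _) (hψi t)] at h1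
    refine le_trans (le_of_eq ?_) h1
    have h2 : ∀ θ, ψ θ * (supersolution γ G V μ T s θ - supersolution γ G V μ T t θ) =
        (∫ r in Ioc s t, ζ r θ) + γ * G ^ 2 * ((t - s) * (T - s) - (t - s) ^ 2 / 2) * ψ θ := by
      intro θ
      rw [h.sub_supersolution, intervalIntegral.integral_of_le hst, mul_add,
        ← integral_const_mul]
      ring
    have hprod : Integrable (Function.uncurry fun θ r => ζ r θ)
        ((μ t).prod (volume.restrict (Ioc s t))) :=
      Integrable.of_bound (hζm.comp measurable_swap).aestronglyMeasurable U
        (Eventually.of_forall fun p => hζU p.2 p.1)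
    rw [integral_const_mul]
    simp only [h2]
    have h3 : Integrable (fun θ => ∫ r in Ioc s t, ζ r θ) (μ t) := hprod.integral_prod_left
    rw [integral_add h3 ((hψi t).const_mul _), integral_const_mul,
      integral_integral_swap hprod, intervalIntegral.integral_of_le hst]
    ring
  -- the contribution of the motion of the measure
  have hsecond := h.integral_sub_integral hα hγ hψ hψL hψ1 hs ht
  have hri := h.intervalIntegrable_wfrRate hα hγ hψ hψL hψ1 s t
  -- replacing `μ t` by `μ r` costs a further factor `t - s`, by Lipschitz continuity in time
  have hpoint : ∀ r ∈ Icc s t, -(α * C₁ * (t - s) + α * γ * G ^ 2 * (T - s) * (A + C₂ * (t - s))) ≤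
      α * J r + wfrRate d α γ (V r) (μ r) ψ := by
    intro r hr
    have hr0 := hs.trans hr.1
    have htr : |t - r| ≤ t - s := by
      rw [abs_of_nonneg (by linarith [hr.2])]
      linarith [hr.1]
    have h1 := h.abs_integral_sub_integral_le hα hγ (hζs r) (hζL r) (hζU r) hr0 ht
    have h2 := h.abs_integral_sub_integral_le hα hγ hψ hψL hψ1 hr0 ht
    have h3 := h.transport_expTest_ge hα hγ hsT r
    have h4 : J r - ∫ θ, ζ r θ ∂(μ r) ≥ -(C₁ * (t - s)) := by
      have h5 : C₁ * |t - r| ≤ C₁ * (t - s) := by gcongr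
      have := (abs_le.1 h1).1
      linarith
    have h5 : ∫ θ, ψ θ ∂(μ r) ≤ A + C₂ * (t - s) := by
      have h5 : C₂ * |t - r| ≤ C₂ * (t - s) := by gcongr
      have := (abs_le.1 h2).1
      linarith
    have h6 : 0 ≤ α * γ * G ^ 2 * (T - s) := by
      have : 0 ≤ T - s := by linarith
      positivity
    have h7 := mul_le_mul_of_nonneg_left h5 h6
    have h8 := mul_le_mul_of_nonneg_left h4 hα
    unfold wfrRate
    change _ ≤ α * J r + (_ - α * ∫ θ, ζ r θ ∂(μ r))
    linarith
  have hint := intervalIntegral.integral_mono_on hst intervalIntegrable_const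
    ((hJi.const_mul α).add hri) hpoint
  rw [intervalIntegral.integral_const, intervalIntegral.integral_add (hJi.const_mul α) hri,
    intervalIntegral.integral_const_mul, ← hsecond, smul_eq_mul] at hint
  have hts : 0 ≤ (t - s) ^ 2 := sq_nonneg _
  have hs2 : α * γ * G ^ 2 * C₂ * (t - s) ^ 2 * (T - s) ≤ α * γ * G ^ 2 * C₂ * (t - s) ^ 2 * T := by
    gcongr
    linarith
  have hs3 : α * γ * G ^ 2 * (t - s) ^ 2 / 2 * A ≤ α * γ * G ^ 2 * (t - s) ^ 2 / 2 * 1 := by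
    gcongr
  linarith

/-- The accumulated mean loss along the flow is at most the soft minimum
`-α⁻¹ log ∫ exp(-α ∫_0^T V_r dr) dμ_0` of the accumulated potential, up to the transport error
`γ G² T² / 2`. -/
theorem exp_mean_ge (h : IsWFRPath d α γ U G V μ) (hα : 0 ≤ α) (hγ : 0 ≤ γ) (hT : 0 ≤ T) :
    ∫ θ, Real.exp (-α * ((∫ r in (0 : ℝ)..T, V r θ) + γ * G ^ 2 * T ^ 2 / 2)) ∂(μ 0) ≤
      Real.exp (-α * ∫ r in (0 : ℝ)..T, ∫ θ, V r θ ∂(μ r)) := by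
  have := h.isProbabilityMeasure
  obtain ⟨C, hC⟩ := h.exists_integral_expTest_sub_ge (T := T) hα hγ
  have h1 := le_of_forall_sub_ge_neg_sq hT hC
  simpa [expTest, supersolution] using h1

end IsWFRPath

end WFRRegret

/-! ### Measurability and averages of paths of measures -/

section PathsOfMeasures

/-- A narrowly continuous path is measurable: the mass of an open set is lower semicontinuous. -/
lemma measurable_toMeasure_of_continuous {X : Type*} [EMetricSpace X] [MeasurableSpace X]
    [BorelSpace X] {μ : ℝ → ProbabilityMeasure X} (hμ : Continuous μ) :
    Measurable fun s => (μ s : Measure X) := by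
  refine Measurable.measure_of_isPiSystem_of_isProbabilityMeasure
    (BorelSpace.measurable_eq (α := X))
    isPiSystem_isOpen fun O hO => ?_
  refine LowerSemicontinuous.measurable ?_
  rw [lowerSemicontinuous_iff_le_liminf]
  exact fun s => ProbabilityMeasure.le_liminf_measure_open_of_tendsto (hμ.tendsto s) hO

lemma measurable_tilted {Ω X : Type*} [MeasurableSpace Ω] [MeasurableSpace X] (m : Measure X)
    [SFinite m] {F : Ω → X → ℝ} (hF : Measurable (Function.uncurry F)) :
    Measurable fun t => m.tilted (F t) := by
  refine Measure.measurable_of_measurable_coe _ fun A hA => ?_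
  simp only [tilted_apply' _ _ hA]
  have h1 : Measurable fun t => ∫ x, Real.exp (F t x) ∂m :=
    (StronglyMeasurable.integral_prod_right (f := fun t x => Real.exp (F t x))
      hF.exp.stronglyMeasurable).measurable
  exact Measurable.lintegral_prod_right'
    (f := fun p : Ω × X => ENNReal.ofReal (Real.exp (F p.1 p.2) / ∫ x, Real.exp (F p.1 x) ∂m))
    (hF.exp.div (h1.comp measurable_fst)).ennreal_ofReal

variable {X : Type*} [MeasurableSpace X] {m : ℝ → Measure X}

lemma timeAvg_congr {m m' : ℝ → Measure X} (h : ∀ s, 0 < s → m s = m' s) (t : ℝ) :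
    timeAvg m t = timeAvg m' t := by
  unfold timeAvg
  rw [Measure.bind_congr_right]
  filter_upwards [ae_restrict_mem measurableSet_Ioc] with s hs using h s hs.1

lemma timeAvg_apply (hm : Measurable m) (t : ℝ) {A : Set X} (hA : MeasurableSet A) :
    timeAvg m t A = ENNReal.ofReal t⁻¹ * ∫⁻ s in Ioc 0 t, m s A := by
  rw [timeAvg, Measure.smul_apply, Measure.bind_apply hA hm.aemeasurable, smul_eq_mul]

lemma measurable_timeAvg (hm : Measurable m) : Measurable (timeAvg m) := by
  refine Measure.measurable_of_measurable_coe _ fun A hA => ?_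
  simp only [timeAvg_apply hm _ hA]
  refine (measurable_inv.ennreal_ofReal).mul (Monotone.measurable fun s t hst => ?_)
  exact lintegral_mono_set (Ioc_subset_Ioc_right hst)

lemma isProbabilityMeasure_timeAvg (hm : Measurable m) [∀ s, IsProbabilityMeasure (m s)] {t : ℝ}
    (ht : 0 < t) : IsProbabilityMeasure (timeAvg m t) := by
  refine ⟨?_⟩
  rw [timeAvg_apply hm _ MeasurableSet.univ]
  simp only [measure_univ, lintegral_const, Measure.restrict_apply MeasurableSet.univ, univ_inter,
    Real.volume_Ioc, sub_zero, one_mul]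
  rw [← ENNReal.ofReal_mul (by positivity), inv_mul_cancel₀ ht.ne', ENNReal.ofReal_one]

/-- Fubini for the time average of a path of measures. -/
lemma integral_timeAvg (hm : Measurable m) [∀ s, IsProbabilityMeasure (m s)] {t : ℝ} (ht : 0 < t)
    {f : X → ℝ} {U : ℝ} (hf : Measurable f) (h0 : ∀ x, 0 ≤ f x) (hU : ∀ x, f x ≤ U) :
    ∫ x, f x ∂(timeAvg m t) = t⁻¹ * ∫ s in (0 : ℝ)..t, ∫ x, f x ∂(m s) := by
  have hint : ∀ s, Integrable f (m s) := fun s =>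
    Integrable.of_bound hf.aestronglyMeasurable U
      (Eventually.of_forall fun x => by rw [Real.norm_eq_abs, abs_of_nonneg (h0 x)]; exact hU x)
  have hmeas : Measurable fun s => ∫ x, f x ∂(m s) :=
    measurable_integral_path hm (F := fun _ => f) (hf.comp measurable_snd)
  rw [integral_eq_lintegral_of_nonneg_ae (Eventually.of_forall h0) hf.aestronglyMeasurable,
    timeAvg, lintegral_smul_measure, Measure.lintegral_bind hm.aemeasurable
      hf.ennreal_ofReal.aemeasurable, intervalIntegral.integral_of_le ht.le,
    integral_eq_lintegral_of_nonneg_ae (Eventually.of_forall fun s => integral_nonneg h0)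
      hmeas.aestronglyMeasurable, smul_eq_mul, ENNReal.toReal_mul,
      ENNReal.toReal_ofReal (by positivity)]
  congr 2
  refine lintegral_congr fun s => ?_
  exact (ofReal_integral_eq_lintegral_ofReal (hint s) (Eventually.of_forall h0)).symm

end PathsOfMeasures

/-! ### Retraction onto the admissible perturbations, and uniform averages -/

section Clamp

variable {dx : ℕ}

/-- The nearest-point retraction of the input space onto the `ℓ_∞` ball of radius `ε` at `x`. -/
def clampBall (ε : ℝ) (x z : Input dx) : Input dx := fun j => max (x j - ε) (min (x j + ε) (z j))

lemma continuous_clampBall (ε : ℝ) (x : Input dx) : Continuous (clampBall ε x) := by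
  unfold clampBall
  fun_prop

lemma clampBall_mem {ε : ℝ} (hε : 0 < ε) (x z : Input dx) : clampBall ε x z ∈ attackBall ε x := by
  rw [attackBall, Metric.mem_closedBall, dist_pi_le_iff hε.le]
  intro j
  rw [Real.dist_eq, abs_le]
  constructor
  · have := le_max_left (x j - ε) (min (x j + ε) (z j))
    simp only [clampBall]; linarith
  · have : max (x j - ε) (min (x j + ε) (z j)) ≤ x j + ε :=
      max_le (by linarith) (min_le_left _ _)
    simp only [clampBall]; linarith

lemma clampBall_of_mem {ε : ℝ} (hε : 0 < ε) {x z : Input dx} (hz : z ∈ attackBall ε x) :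
    clampBall ε x z = z := by
  rw [attackBall, Metric.mem_closedBall, dist_pi_le_iff hε.le] at hz
  funext j
  have := abs_le.1 (hz j)
  rw [clampBall, min_eq_right (by linarith [this.2]), max_eq_right (by linarith [this.1])]

lemma measurableSet_attackBall (ε : ℝ) (x : Input dx) : MeasurableSet (attackBall ε x) :=
  Metric.isClosed_closedBall.measurableSet

end Clamp

/-- Expectation under the uniform law on `Fin N`. -/
lemma integral_uniform_fin {N : ℕ} (f : Fin N → ℝ) :
    ∫ i, f i ∂((N : ℝ≥0∞)⁻¹ • Measure.count) = (1 / (N : ℝ)) * ∑ i, f i := by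
  rw [integral_smul_measure, integral_count]
  simp

lemma uniform_fin_univ {N : ℕ} (hN : 0 < N) :
    ((N : ℝ≥0∞)⁻¹ • (Measure.count : Measure (Fin N))) univ = 1 := by
  rw [Measure.smul_apply, Measure.count_univ, smul_eq_mul]
  simp only [ENat.card_eq_coe_fintype_card, Fintype.card_fin]
  exact ENNReal.inv_mul_cancel (by exact_mod_cast hN.ne') (by simp)

/-! ### Regularity of the potential -/

section Potential

variable {d : ℕ} {Θ : Type*} [EMetricSpace Θ] [CompactSpace Θ] [MeasurableSpace Θ] [BorelSpace Θ]
  [ChartedSpace (EuclideanSpace ℝ (Fin d)) Θ]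
  [IsManifold 𝓘(ℝ, EuclideanSpace ℝ (Fin d)) ∞ Θ]
  {Y : Type*} {dx N : ℕ} {U ε : ℝ} {G : ℝ≥0} {𝓧 : Set (Input dx)} {ℓ : Θ → Input dx → Y → ℝ}

/-- The loss at the point `y`, with the input retracted onto the admissible ball. It agrees with
`ℓ` on that ball, and has there and elsewhere the regularity that `ℓ` has on admissible inputs. -/
def clampedLoss (ℓ : Θ → Input dx → Y → ℝ) (ε : ℝ) (x : Input dx) (y : Y) (θ : Θ)
    (z : Input dx) : ℝ := ℓ θ (clampBall ε x z) y

omit [IsManifold 𝓘(ℝ, EuclideanSpace ℝ (Fin d)) ∞ Θ] in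
lemma measurable_clampedLoss (hℓ : IsAdmissibleLoss d U G 𝓧 ℓ) (hε : 0 < ε) {x : Input dx}
    (hx : attackBall ε x ⊆ 𝓧) (y : Y) :
    Measurable (Function.uncurry fun z θ => clampedLoss ℓ ε x y θ z) := by
  refine measurable_uncurry_of_caratheodory
    (fun z => (hℓ.lipschitz_param _ (hx (clampBall_mem hε x z)) y).continuous) fun θ => ?_
  exact ((hℓ.lipschitz_input θ y).continuousOn.comp_continuous (continuous_clampBall ε x)
    fun z => hx (clampBall_mem hε x z)).measurable

omit [CompactSpace Θ] [MeasurableSpace Θ] [BorelSpace Θ]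
  [IsManifold 𝓘(ℝ, EuclideanSpace ℝ (Fin d)) ∞ Θ] in
lemma clampedLoss_nonneg (hℓ : IsAdmissibleLoss d U G 𝓧 ℓ) (hε : 0 < ε) {x : Input dx}
    (hx : attackBall ε x ⊆ 𝓧) (y : Y) (θ : Θ) (z : Input dx) : 0 ≤ clampedLoss ℓ ε x y θ z :=
  hℓ.nonneg θ _ (hx (clampBall_mem hε x z)) y

omit [CompactSpace Θ] [MeasurableSpace Θ] [BorelSpace Θ]
  [IsManifold 𝓘(ℝ, EuclideanSpace ℝ (Fin d)) ∞ Θ] in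
lemma clampedLoss_le (hℓ : IsAdmissibleLoss d U G 𝓧 ℓ) (hε : 0 < ε) {x : Input dx}
    (hx : attackBall ε x ⊆ 𝓧) (y : Y) (θ : Θ) (z : Input dx) : clampedLoss ℓ ε x y θ z ≤ U :=
  hℓ.le_bound θ _ (hx (clampBall_mem hε x z)) y

omit [CompactSpace Θ] [MeasurableSpace Θ] [BorelSpace Θ]
  [IsManifold 𝓘(ℝ, EuclideanSpace ℝ (Fin d)) ∞ Θ] in
lemma abs_clampedLoss_le (hℓ : IsAdmissibleLoss d U G 𝓧 ℓ) (hε : 0 < ε) {x : Input dx}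
    (hx : attackBall ε x ⊆ 𝓧) (y : Y) (z : Input dx) (θ : Θ) : |clampedLoss ℓ ε x y θ z| ≤ U := by
  rw [abs_of_nonneg (clampedLoss_nonneg hℓ hε hx y θ z)]
  exact clampedLoss_le hℓ hε hx y θ z

omit [EMetricSpace Θ] [CompactSpace Θ] [MeasurableSpace Θ] [BorelSpace Θ]
  [ChartedSpace (EuclideanSpace ℝ (Fin d)) Θ]
  [IsManifold 𝓘(ℝ, EuclideanSpace ℝ (Fin d)) ∞ Θ] in
lemma integral_clampedLoss (hε : 0 < ε) {x : Input dx} (y : Y) {m : Measure (Input dx)}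
    (hm : m (attackBall ε x)ᶜ = 0) (θ : Θ) :
    ∫ z, clampedLoss ℓ ε x y θ z ∂m = ∫ z, ℓ θ z y ∂m := by
  refine integral_congr_ae ?_
  have : ∀ᵐ z ∂m, z ∈ attackBall ε x := by
    rw [ae_iff]; exact hm
  filter_upwards [this] with z hz
  rw [clampedLoss, clampBall_of_mem hε hz]

variable {ν : Fin N → Measure (Input dx)} {x : Fin N → Input dx} {y : Fin N → Y}

omit [EMetricSpace Θ] [CompactSpace Θ] [MeasurableSpace Θ] [BorelSpace Θ]
  [ChartedSpace (EuclideanSpace ℝ (Fin d)) Θ]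
  [IsManifold 𝓘(ℝ, EuclideanSpace ℝ (Fin d)) ∞ Θ] in
/-- Against measures supported on the admissible balls the potential does not see the loss outside
them. -/
lemma potential_eq_clamped (hε : 0 < ε) (hν : ∀ i, ν i (attackBall ε (x i))ᶜ = 0) (θ : Θ) :
    potential ℓ y ν θ = (1 / (N : ℝ)) * ∑ i, ∫ z, clampedLoss ℓ ε (x i) (y i) θ z ∂(ν i) := by
  unfold potential
  congr 1
  exact Finset.sum_congr rfl fun i _ => (integral_clampedLoss hε (y i) (hν i) θ).symm

omit [EMetricSpace Θ] [CompactSpace Θ] [MeasurableSpace Θ] [BorelSpace Θ]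
  [ChartedSpace (EuclideanSpace ℝ (Fin d)) Θ]
  [IsManifold 𝓘(ℝ, EuclideanSpace ℝ (Fin d)) ∞ Θ] in
/-- The potential as an iterated average of the loss, over the data and the perturbations. -/
lemma potential_eq_integral (hε : 0 < ε) (hν : ∀ i, ν i (attackBall ε (x i))ᶜ = 0) :
    potential ℓ y ν = fun θ =>
      ∫ i, ∫ z, clampedLoss ℓ ε (x i) (y i) θ z ∂(ν i) ∂((N : ℝ≥0∞)⁻¹ • Measure.count) := by
  funext θ
  rw [potential_eq_clamped hε hν, integral_uniform_fin]

omit [IsManifold 𝓘(ℝ, EuclideanSpace ℝ (Fin d)) ∞ Θ] in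
lemma lipschitz_integral_clampedLoss (hℓ : IsAdmissibleLoss d U G 𝓧 ℓ) (hε : 0 < ε) {x : Input dx}
    (hx : attackBall ε x ⊆ 𝓧) (y : Y) (m : Measure (Input dx)) [IsProbabilityMeasure m] :
    LipschitzWith G fun θ => ∫ z, clampedLoss ℓ ε x y θ z ∂m := by
  have h := lipschitzWith_integral m
    (fun z => hℓ.lipschitz_param _ (hx (clampBall_mem hε x z)) y)
    (fun θ => (measurable_clampedLoss hℓ hε hx y).comp measurable_prodMk_right)
    (fun z θ => abs_clampedLoss_le hℓ hε hx y z θ)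
  simpa [clampedLoss] using h

omit [CompactSpace Θ] [MeasurableSpace Θ] [BorelSpace Θ]
  [IsManifold 𝓘(ℝ, EuclideanSpace ℝ (Fin d)) ∞ Θ] in
lemma abs_integral_clampedLoss_le (hℓ : IsAdmissibleLoss d U G 𝓧 ℓ) (hε : 0 < ε) {x : Input dx}
    (hx : attackBall ε x ⊆ 𝓧) (y : Y) (m : Measure (Input dx)) [IsProbabilityMeasure m] (θ : Θ) :
    |∫ z, clampedLoss ℓ ε x y θ z ∂m| ≤ U := by
  have := norm_integral_le_of_norm_le_const (μ := m) (f := fun z => clampedLoss ℓ ε x y θ z)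
    (Eventually.of_forall fun z => abs_clampedLoss_le hℓ hε hx y z θ)
  rwa [probReal_univ, mul_one] at this

omit [IsManifold 𝓘(ℝ, EuclideanSpace ℝ (Fin d)) ∞ Θ] in
lemma lipschitzWith_potential (hN : 0 < N) (hℓ : IsAdmissibleLoss d U G 𝓧 ℓ) (hε : 0 < ε)
    (hx : ∀ i, attackBall ε (x i) ⊆ 𝓧) (hν : ∀ i, ν i (attackBall ε (x i))ᶜ = 0)
    [∀ i, IsProbabilityMeasure (ν i)] : LipschitzWith G (potential ℓ y ν) := by
  have : IsProbabilityMeasure ((N : ℝ≥0∞)⁻¹ • (Measure.count : Measure (Fin N))) :=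
    ⟨uniform_fin_univ hN⟩
  have h := lipschitzWith_integral ((N : ℝ≥0∞)⁻¹ • (Measure.count : Measure (Fin N)))
    (fun i => lipschitz_integral_clampedLoss hℓ hε (hx i) (y i) (ν i))
    (fun θ => measurable_of_finite _)
    (fun i θ => abs_integral_clampedLoss_le hℓ hε (hx i) (y i) (ν i) θ)
  rw [potential_eq_integral hε hν]
  simpa using h

omit [CompactSpace Θ] [MeasurableSpace Θ] [BorelSpace Θ]
  [IsManifold 𝓘(ℝ, EuclideanSpace ℝ (Fin d)) ∞ Θ] in
lemma potential_nonneg (hℓ : IsAdmissibleLoss d U G 𝓧 ℓ) (hε : 0 < ε)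
    (hx : ∀ i, attackBall ε (x i) ⊆ 𝓧) (hν : ∀ i, ν i (attackBall ε (x i))ᶜ = 0) (θ : Θ) :
    0 ≤ potential ℓ y ν θ := by
  rw [potential_eq_clamped hε hν]
  exact mul_nonneg (by positivity) (Finset.sum_nonneg fun i _ =>
    integral_nonneg fun z => clampedLoss_nonneg hℓ hε (hx i) (y i) θ z)

omit [CompactSpace Θ] [MeasurableSpace Θ] [BorelSpace Θ]
  [IsManifold 𝓘(ℝ, EuclideanSpace ℝ (Fin d)) ∞ Θ] in
lemma potential_le (hN : 0 < N) (hℓ : IsAdmissibleLoss d U G 𝓧 ℓ) (hε : 0 < ε)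
    (hx : ∀ i, attackBall ε (x i) ⊆ 𝓧) (hν : ∀ i, ν i (attackBall ε (x i))ᶜ = 0)
    [∀ i, IsProbabilityMeasure (ν i)] (θ : Θ) : potential ℓ y ν θ ≤ U := by
  rw [potential_eq_clamped hε hν]
  have h1 : ∑ i, ∫ z, clampedLoss ℓ ε (x i) (y i) θ z ∂(ν i) ≤ ∑ _i : Fin N, U :=
    Finset.sum_le_sum fun i _ =>
      (le_abs_self _).trans (abs_integral_clampedLoss_le hℓ hε (hx i) (y i) (ν i) θ)
  rw [Finset.sum_const, Finset.card_fin, nsmul_eq_mul] at h1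
  have hN' : (0 : ℝ) < N := by exact_mod_cast hN
  rw [one_div, inv_mul_le_iff₀ hN']
  exact h1

omit [IsManifold 𝓘(ℝ, EuclideanSpace ℝ (Fin d)) ∞ Θ] in
/-- The risk is the mean of the potential. -/
lemma risk_eq_integral_potential (hℓ : IsAdmissibleLoss d U G 𝓧 ℓ) (hε : 0 < ε)
    (hx : ∀ i, attackBall ε (x i) ⊆ 𝓧) (hν : ∀ i, ν i (attackBall ε (x i))ᶜ = 0)
    [∀ i, IsProbabilityMeasure (ν i)] (m : Measure Θ) [IsFiniteMeasure m] :
    risk ℓ y m ν = ∫ θ, potential ℓ y ν θ ∂m := by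
  unfold risk potential
  rw [integral_const_mul, integral_finsetSum]
  intro i _
  simp only [← integral_clampedLoss (ℓ := ℓ) hε (y i) (hν i)]
  exact (lipschitz_integral_clampedLoss hℓ hε (hx i) (y i) (ν i)).continuous.integrable_of_compact m

variable [RiemannianBundle (fun θ : Θ => TangentSpace 𝓘(ℝ, EuclideanSpace ℝ (Fin d)) θ)]
  [IsContinuousRiemannianBundle (EuclideanSpace ℝ (Fin d))
    (fun θ : Θ => TangentSpace 𝓘(ℝ, EuclideanSpace ℝ (Fin d)) θ)]
  [IsRiemannianManifold 𝓘(ℝ, EuclideanSpace ℝ (Fin d)) Θ]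

lemma contMDiff_potential (hN : 0 < N) (hℓ : IsAdmissibleLoss d U G 𝓧 ℓ) (hε : 0 < ε)
    (hx : ∀ i, attackBall ε (x i) ⊆ 𝓧) (hν : ∀ i, ν i (attackBall ε (x i))ᶜ = 0)
    [∀ i, IsProbabilityMeasure (ν i)] :
    ContMDiff 𝓘(ℝ, EuclideanSpace ℝ (Fin d)) 𝓘(ℝ, ℝ) 1 (potential ℓ y ν) := by
  have : IsProbabilityMeasure ((N : ℝ≥0∞)⁻¹ • (Measure.count : Measure (Fin N))) :=
    ⟨uniform_fin_univ hN⟩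
  rw [potential_eq_integral hε hν]
  refine contMDiff_integral _ (fun i => ?_)
    (fun i => lipschitz_integral_clampedLoss hℓ hε (hx i) (y i) (ν i))
    (fun θ => measurable_of_finite _)
    (fun i θ => abs_integral_clampedLoss_le hℓ hε (hx i) (y i) (ν i) θ)
  exact contMDiff_integral (ν i)
    (fun z => hℓ.contMDiff_param _ (hx i (clampBall_mem hε (x i) z)) (y i))
    (fun z => hℓ.lipschitz_param _ (hx i (clampBall_mem hε (x i) z)) (y i))
    (fun θ => (measurable_clampedLoss hℓ hε (hx i) (y i)).comp measurable_prodMk_right)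
    (fun z θ => abs_clampedLoss_le hℓ hε (hx i) (y i) z θ)

end Potential

/-! ### Wasserstein–Fisher–Rao paths from the WFR-LBR flow -/

section Flow

variable {d : ℕ} {Θ : Type*} [EMetricSpace Θ] [CompactSpace Θ] [MeasurableSpace Θ] [BorelSpace Θ]
  [ChartedSpace (EuclideanSpace ℝ (Fin d)) Θ]
  [IsManifold 𝓘(ℝ, EuclideanSpace ℝ (Fin d)) ∞ Θ]
  [RiemannianBundle (fun θ : Θ => TangentSpace 𝓘(ℝ, EuclideanSpace ℝ (Fin d)) θ)]
  {Y : Type*} {dx N : ℕ} {α γ β ε U : ℝ} {G : ℝ≥0} {𝓧 : Set (Input dx)}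
  {ℓ : Θ → Input dx → Y → ℝ} {x : Fin N → Input dx} {y : Fin N → Y}
  {μ₀ : ProbabilityMeasure Θ} {ν₀ : Fin N → ProbabilityMeasure (Input dx)}
  {μ : ℝ → ProbabilityMeasure Θ} {ν : ℝ → Fin N → ProbabilityMeasure (Input dx)}

omit [EMetricSpace Θ] [CompactSpace Θ] [BorelSpace Θ]
  [ChartedSpace (EuclideanSpace ℝ (Fin d)) Θ]
  [IsManifold 𝓘(ℝ, EuclideanSpace ℝ (Fin d)) ∞ Θ]
  [RiemannianBundle (fun θ : Θ => TangentSpace 𝓘(ℝ, EuclideanSpace ℝ (Fin d)) θ)] in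
/-- Each logit response only involves the loss on the admissible ball. -/
lemma logitResponse_eq_clamped (hε : 0 < ε) (x : Input dx) (y : Y) (m : Measure Θ) :
    logitResponse β ε ℓ x y m = (volume.restrict (attackBall ε x)).tilted
      fun z => β⁻¹ * ∫ θ, clampedLoss ℓ ε x y θ z ∂m := by
  refine tilted_congr ?_
  filter_upwards [ae_restrict_mem (measurableSet_attackBall ε x)] with z hz
  simp only [clampedLoss, clampBall_of_mem hε hz]

omit [IsManifold 𝓘(ℝ, EuclideanSpace ℝ (Fin d)) ∞ Θ]
  [RiemannianBundle (fun θ : Θ => TangentSpace 𝓘(ℝ, EuclideanSpace ℝ (Fin d)) θ)] in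
lemma measurable_logitResponse {Ω : Type*} [MeasurableSpace Ω] (hℓ : IsAdmissibleLoss d U G 𝓧 ℓ)
    (hε : 0 < ε) {x : Input dx} (hx : attackBall ε x ⊆ 𝓧) (y : Y) {m : Ω → Measure Θ}
    [∀ s, IsProbabilityMeasure (m s)] (hm : Measurable m) :
    Measurable fun s => logitResponse β ε ℓ x y (m s) := by
  simp only [logitResponse_eq_clamped hε]
  have : IsFiniteMeasure (volume.restrict (attackBall ε x)) :=
    ⟨by rw [Measure.restrict_apply_univ]; exact measure_closedBall_lt_top⟩
  refine measurable_tilted _ (F := fun s z => β⁻¹ * ∫ θ, clampedLoss ℓ ε x y θ z ∂(m s)) ?_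
  refine Measurable.const_mul ?_ _
  exact measurable_integral_path (μ := fun p : Ω × Input dx => m p.1) (hm.comp measurable_fst)
    (F := fun p θ => clampedLoss ℓ ε x y θ p.2)
    ((measurable_clampedLoss hℓ hε hx y).comp
      ((measurable_snd.comp measurable_fst).prodMk measurable_snd))

namespace AdvTraining.IsWFRLBRFlow

omit [CompactSpace Θ] in
lemma measurable_classifier (h : IsWFRLBRFlow d α γ β ε ℓ x y μ₀ ν₀ μ ν) :
    Measurable fun s => (μ (max s 0) : Measure Θ) :=
  measurable_toMeasure_of_continuous
    (h.classifier.continuousOn.comp_continuous (by fun_prop) fun s => le_max_right s 0)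

omit [CompactSpace Θ] in
lemma attacker_compl_eq_zero (h : IsWFRLBRFlow d α γ β ε ℓ x y μ₀ ν₀ μ ν) {s : ℝ} (hs : 0 ≤ s)
    (i : Fin N) : (ν s i : Measure (Input dx)) (attackBall ε (x i))ᶜ = 0 := by
  rcases lt_or_ge s 1 with h1 | h1
  · rw [h.attacker_initial s hs h1]
    exact h.attacker_supported i
  · rw [h.attacker_response s h1 i]
    apply tilted_absolutelyContinuous
    rw [Measure.restrict_apply (measurableSet_attackBall _ _).compl]
    simp

/-- The attacker depends measurably on time, as the logit responses depend measurably on the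
averaged classifier. Negative times are sent to `0`. -/
lemma measurable_attacker (h : IsWFRLBRFlow d α γ β ε ℓ x y μ₀ ν₀ μ ν)
    (hℓ : IsAdmissibleLoss d U G 𝓧 ℓ) (hε : 0 < ε) (hx : ∀ i, attackBall ε (x i) ⊆ 𝓧) (i : Fin N) :
    Measurable fun s => (ν (max s 0) i : Measure (Input dx)) := by
  have hμ := h.measurable_classifier
  have heq : (fun s => (ν (max s 0) i : Measure (Input dx))) = fun s =>
      if s < 1 then (ν₀ i : Measure (Input dx)) else
        logitResponse β ε ℓ (x i) (y i)
          (timeAvg (fun s => (μ (max s 0) : Measure Θ)) (max s 1)) := by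
    funext s
    split_ifs with hs
    · rw [h.attacker_initial _ (le_max_right _ _) (max_lt hs one_pos)]
    · have hs := not_lt.1 hs
      rw [max_eq_left (zero_le_one.trans hs), max_eq_left hs, h.attacker_response s hs i,
        timeAvg_congr (m' := fun s => (μ (max s 0) : Measure Θ))]
      intro r hr
      simp only [max_eq_left hr.le]
  rw [heq]
  -- `max s 1` keeps the averaging time positive where the branch `s < 1` is taken
  have hp : ∀ s : ℝ, IsProbabilityMeasure
      (timeAvg (fun s => (μ (max s 0) : Measure Θ)) (max s 1)) := fun s =>
    isProbabilityMeasure_timeAvg hμ (lt_max_of_lt_right one_pos)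
  exact Measurable.ite measurableSet_Iio measurable_const
    (measurable_logitResponse hℓ hε (hx i) (y i)
      ((measurable_timeAvg hμ).comp (measurable_id.max measurable_const)))

variable [IsContinuousRiemannianBundle (EuclideanSpace ℝ (Fin d))
    (fun θ : Θ => TangentSpace 𝓘(ℝ, EuclideanSpace ℝ (Fin d)) θ)]
  [IsRiemannianManifold 𝓘(ℝ, EuclideanSpace ℝ (Fin d)) Θ]

/-- The classifier of a WFR-LBR flow, extended to negative times by its initial value, is a
Wasserstein–Fisher–Rao path for the potential generated by the attacker. -/
lemma isWFRPath (h : IsWFRLBRFlow d α γ β ε ℓ x y μ₀ ν₀ μ ν) (hN : 0 < N)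
    (hℓ : IsAdmissibleLoss d U G 𝓧 ℓ) (hε : 0 < ε) (hx : ∀ i, attackBall ε (x i) ⊆ 𝓧) :
    IsWFRPath d α γ U G
      (fun s => potential ℓ y (fun i => (ν (max s 0) i : Measure (Input dx))))
      (fun s => (μ (max s 0) : Measure Θ)) where
  isProbabilityMeasure s := inferInstance
  measurable_path := h.measurable_classifier
  contMDiff s := contMDiff_potential hN hℓ hε hx
    fun i => h.attacker_compl_eq_zero (le_max_right s 0) i
  lipschitz s := lipschitzWith_potential hN hℓ hε hx
    fun i => h.attacker_compl_eq_zero (le_max_right s 0) i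
  nonneg s := potential_nonneg hℓ hε hx
    fun i => h.attacker_compl_eq_zero (le_max_right s 0) i
  le_bound s := potential_le hN hℓ hε hx
    fun i => h.attacker_compl_eq_zero (le_max_right s 0) i
  measurable_potential θ := by
    have h1 : ∀ s, potential ℓ y (fun i => (ν (max s 0) i : Measure (Input dx))) θ =
        (1 / (N : ℝ)) * ∑ i, ∫ z, clampedLoss ℓ ε (x i) (y i) θ z
          ∂(ν (max s 0) i : Measure (Input dx)) := fun s =>
      potential_eq_clamped hε (fun i => h.attacker_compl_eq_zero (le_max_right s 0) i) θ
    simp only [h1]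
    refine (Finset.measurable_fun_sum _ fun i _ => ?_).const_mul _
    exact measurable_integral_path (h.measurable_attacker hℓ hε hx i)
      (F := fun _ z => clampedLoss ℓ ε (x i) (y i) θ z)
      (((measurable_clampedLoss hℓ hε (hx i) (y i)).comp measurable_prodMk_right).comp
        measurable_snd)
  weak ψ hψ t ht := by
    simp only [max_eq_left ht, max_self, h.classifier.initial]
    rw [h.classifier.weak ψ hψ t ht]
    congr 1
    refine intervalIntegral.integral_congr fun s hs => ?_
    rw [uIcc_of_le ht] at hs
    simp only [max_eq_left hs.1]
    rfl

omit [IsContinuousRiemannianBundle (EuclideanSpace ℝ (Fin d))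
    (fun θ : Θ => TangentSpace 𝓘(ℝ, EuclideanSpace ℝ (Fin d)) θ)]
  [IsRiemannianManifold 𝓘(ℝ, EuclideanSpace ℝ (Fin d)) Θ] in
lemma avgAttacker_eq (ν : ℝ → Fin N → ProbabilityMeasure (Input dx)) (T : ℝ) (i : Fin N) :
    avgAttacker ν T i = timeAvg (fun s => (ν (max s 0) i : Measure (Input dx))) T :=
  timeAvg_congr (fun s hs => by simp only [max_eq_left hs.le]) T

omit [IsContinuousRiemannianBundle (EuclideanSpace ℝ (Fin d))
    (fun θ : Θ => TangentSpace 𝓘(ℝ, EuclideanSpace ℝ (Fin d)) θ)]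
  [IsRiemannianManifold 𝓘(ℝ, EuclideanSpace ℝ (Fin d)) Θ] in
lemma isProbabilityMeasure_avgAttacker (h : IsWFRLBRFlow d α γ β ε ℓ x y μ₀ ν₀ μ ν)
    (hℓ : IsAdmissibleLoss d U G 𝓧 ℓ) (hε : 0 < ε) (hx : ∀ i, attackBall ε (x i) ⊆ 𝓧)
    {T : ℝ} (hT : 0 < T) (i : Fin N) : IsProbabilityMeasure (avgAttacker ν T i) := by
  rw [avgAttacker_eq]
  exact isProbabilityMeasure_timeAvg (h.measurable_attacker hℓ hε hx i) hT

omit [IsContinuousRiemannianBundle (EuclideanSpace ℝ (Fin d))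
    (fun θ : Θ => TangentSpace 𝓘(ℝ, EuclideanSpace ℝ (Fin d)) θ)]
  [IsRiemannianManifold 𝓘(ℝ, EuclideanSpace ℝ (Fin d)) Θ] in
lemma avgAttacker_compl_eq_zero (h : IsWFRLBRFlow d α γ β ε ℓ x y μ₀ ν₀ μ ν)
    (hℓ : IsAdmissibleLoss d U G 𝓧 ℓ) (hε : 0 < ε) (hx : ∀ i, attackBall ε (x i) ⊆ 𝓧)
    (T : ℝ) (i : Fin N) : avgAttacker ν T i (attackBall ε (x i))ᶜ = 0 := by
  rw [avgAttacker_eq, timeAvg_apply (h.measurable_attacker hℓ hε hx i) _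
    (measurableSet_attackBall _ _).compl]
  simp [h.attacker_compl_eq_zero (le_max_right _ 0) i]

omit [IsContinuousRiemannianBundle (EuclideanSpace ℝ (Fin d))
    (fun θ : Θ => TangentSpace 𝓘(ℝ, EuclideanSpace ℝ (Fin d)) θ)]
  [IsRiemannianManifold 𝓘(ℝ, EuclideanSpace ℝ (Fin d)) Θ] in
/-- The potential of the averaged attacker is the time average of the potentials. -/
lemma potential_avgAttacker (h : IsWFRLBRFlow d α γ β ε ℓ x y μ₀ ν₀ μ ν)
    (hℓ : IsAdmissibleLoss d U G 𝓧 ℓ) (hε : 0 < ε) (hx : ∀ i, attackBall ε (x i) ⊆ 𝓧)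
    {T : ℝ} (hT : 0 < T) (θ : Θ) :
    potential ℓ y (avgAttacker ν T) θ = T⁻¹ * ∫ s in (0 : ℝ)..T,
      potential ℓ y (fun i => (ν (max s 0) i : Measure (Input dx))) θ := by
  have hmeas : ∀ i, Measurable fun z => clampedLoss ℓ ε (x i) (y i) θ z := fun i =>
    (measurable_clampedLoss hℓ hε (hx i) (y i)).comp measurable_prodMk_right
  have h1 : ∀ s, potential ℓ y (fun i => (ν (max s 0) i : Measure (Input dx))) θ =
      (1 / (N : ℝ)) * ∑ i, ∫ z, clampedLoss ℓ ε (x i) (y i) θ z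
        ∂(ν (max s 0) i : Measure (Input dx)) := fun s =>
    potential_eq_clamped hε (fun i => h.attacker_compl_eq_zero (le_max_right s 0) i) θ
  have hint : ∀ i, IntervalIntegrable (fun s => ∫ z, clampedLoss ℓ ε (x i) (y i) θ z
      ∂(ν (max s 0) i : Measure (Input dx))) volume 0 T := fun i =>
    intervalIntegrable_const (c := U) |>.mono_fun
      (measurable_integral_path (h.measurable_attacker hℓ hε hx i)
        (F := fun _ z => clampedLoss ℓ ε (x i) (y i) θ z)
        ((hmeas i).comp measurable_snd)).aestronglyMeasurable
      (Eventually.of_forall fun s => by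
        exact (abs_integral_clampedLoss_le hℓ hε (hx i) (y i) _ θ).trans (le_abs_self _))
  rw [potential_eq_clamped hε (h.avgAttacker_compl_eq_zero hℓ hε hx T)]
  simp only [h1]
  rw [intervalIntegral.integral_const_mul, intervalIntegral.integral_finsetSum fun i _ => hint i]
  simp only [avgAttacker_eq]
  rw [Finset.sum_congr rfl fun i _ => integral_timeAvg (h.measurable_attacker hℓ hε hx i) hT
    (hmeas i) (clampedLoss_nonneg hℓ hε (hx i) (y i) θ) (clampedLoss_le hℓ hε (hx i) (y i) θ),
    ← Finset.mul_sum]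
  ring

end AdvTraining.IsWFRLBRFlow

end Flow

/-! ### Regret against a fixed classifier -/

section Regret

variable {d : ℕ} {Θ : Type*} [EMetricSpace Θ] [CompactSpace Θ] [MeasurableSpace Θ] [BorelSpace Θ]
  [ChartedSpace (EuclideanSpace ℝ (Fin d)) Θ]
  [IsManifold 𝓘(ℝ, EuclideanSpace ℝ (Fin d)) ∞ Θ]
  [RiemannianBundle (fun θ : Θ => TangentSpace 𝓘(ℝ, EuclideanSpace ℝ (Fin d)) θ)]
  [IsContinuousRiemannianBundle (EuclideanSpace ℝ (Fin d))
    (fun θ : Θ => TangentSpace 𝓘(ℝ, EuclideanSpace ℝ (Fin d)) θ)]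
  [IsRiemannianManifold 𝓘(ℝ, EuclideanSpace ℝ (Fin d)) Θ]
  {α γ U T : ℝ} {G : ℝ≥0} {V : ℝ → Θ → ℝ} {μ : ℝ → Measure Θ}

/-- Regret of the flow against a fixed classifier `θ`, in terms of the initial mass of a ball
around `θ`. -/
theorem IsWFRPath.integral_mean_le (h : IsWFRPath d α γ U G V μ) (hα : 0 < α) (hγ : 0 ≤ γ)
    (hT : 0 ≤ T) (θ : Θ) {r a : ℝ} (hr : 0 ≤ r) (ha : 0 < a)
    (hball : ENNReal.ofReal a ≤ μ 0 (Metric.eball θ (ENNReal.ofReal r))) :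
    ∫ t in (0 : ℝ)..T, ∫ θ', V t θ' ∂(μ t) ≤
      (∫ t in (0 : ℝ)..T, V t θ) + T * (G * r) + γ * G ^ 2 * T ^ 2 / 2 - Real.log a / α := by
  have := h.isProbabilityMeasure 0
  set P : Θ → ℝ := fun θ => ∫ t in (0 : ℝ)..T, V t θ with hP
  set W := ∫ t in (0 : ℝ)..T, ∫ θ', V t θ' ∂(μ t) with hW
  set q := γ * G ^ 2 * T ^ 2 / 2 with hq
  set B := Metric.eball θ (ENNReal.ofReal r) with hB
  have hBm : MeasurableSet B := Metric.isOpen_eball.measurableSet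
  have hVL : ∀ t, ∀ θ' ∈ B, V t θ' ≤ V t θ + G * r := by
    intro t θ' hθ'
    have h1 := (h.lipschitz t) θ' θ
    have h2 : edist (V t θ') (V t θ) ≤ ENNReal.ofReal (G * r) := by
      refine h1.trans ?_
      rw [ENNReal.ofReal_mul (by positivity), ENNReal.ofReal_coe_nnreal]
      gcongr
      exact (Metric.mem_eball.1 hθ').le
    rw [edist_dist, ENNReal.ofReal_le_ofReal_iff (by positivity), Real.dist_eq] at h2
    linarith [(abs_le.1 h2).2]
  have hPB : ∀ θ' ∈ B, P θ' ≤ P θ + T * (G * r) := by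
    intro θ' hθ'
    have h1 := intervalIntegral.integral_mono_on hT (h.intervalIntegrable_potential θ' 0 T)
      ((h.intervalIntegrable_potential θ 0 T).add (intervalIntegrable_const (c := G * r)))
      fun t _ => hVL t θ' hθ'
    rw [intervalIntegral.integral_add (h.intervalIntegrable_potential θ 0 T)
      intervalIntegrable_const, intervalIntegral.integral_const, smul_eq_mul, sub_zero] at h1
    exact h1
  have hcont : Continuous fun θ => Real.exp (-α * (P θ + q)) := by
    have h1 : Continuous P := by
      have h2 := lipschitzWith_integral (volume.restrict (Ioc 0 T)) h.lipschitz
        h.measurable_potential h.abs_potential_le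
      simp only [hP, intervalIntegral.integral_of_le hT]
      exact h2.continuous
    fun_prop
  -- restrict the exponential inequality to the ball, where `P ≤ P θ + T (G r)`
  have hmain : a * Real.exp (-α * (P θ + T * (G * r) + q)) ≤ Real.exp (-α * W) := by
    refine le_trans ?_ (h.exp_mean_ge hα.le hγ hT)
    have ha' : a ≤ (μ 0).real B :=
      (ENNReal.ofReal_le_iff_le_toReal (measure_ne_top _ _)).1 hball
    calc a * Real.exp (-α * (P θ + T * (G * r) + q))
        ≤ (μ 0).real B * Real.exp (-α * (P θ + T * (G * r) + q)) := by gcongr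
      _ = ∫ _ in B, Real.exp (-α * (P θ + T * (G * r) + q)) ∂(μ 0) := by
          rw [setIntegral_const, smul_eq_mul]
      _ ≤ ∫ θ' in B, Real.exp (-α * (P θ' + q)) ∂(μ 0) := by
          refine setIntegral_mono_on (integrable_const _)
            (hcont.integrable_of_compact _).integrableOn hBm fun θ' hθ' => ?_
          rw [Real.exp_le_exp]
          have := hPB θ' hθ'
          nlinarith
      _ ≤ ∫ θ', Real.exp (-α * (P θ' + q)) ∂(μ 0) :=
          setIntegral_le_integral (hcont.integrable_of_compact _)
            (Eventually.of_forall fun θ' => (Real.exp_pos _).le)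
  have hlog := Real.log_le_log (by positivity) hmain
  rw [Real.log_mul ha.ne' (Real.exp_pos _).ne', Real.log_exp, Real.log_exp] at hlog
  have h1 : α * W ≤ α * (P θ + T * (G * r) + q - Real.log a / α) := by
    rw [mul_sub, mul_div_cancel₀ _ hα.ne']
    linarith
  exact le_of_mul_le_mul_left h1 hα

end Regret

/-! ### The regret bound -/

section Radius

/-- A smooth Riemannian metric on the tangent bundle is continuous. -/
lemma isContinuousRiemannianBundle_of_isContMDiffRiemannianBundle {d : ℕ}
    {Θ : Type*} [EMetricSpace Θ] [ChartedSpace (EuclideanSpace ℝ (Fin d)) Θ]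
    [IsManifold 𝓘(ℝ, EuclideanSpace ℝ (Fin d)) ∞ Θ]
    [RiemannianBundle (fun θ : Θ => TangentSpace 𝓘(ℝ, EuclideanSpace ℝ (Fin d)) θ)]
    [h : IsContMDiffRiemannianBundle 𝓘(ℝ, EuclideanSpace ℝ (Fin d)) ∞ (EuclideanSpace ℝ (Fin d))
      (fun θ : Θ => TangentSpace 𝓘(ℝ, EuclideanSpace ℝ (Fin d)) θ)] :
    IsContinuousRiemannianBundle (EuclideanSpace ℝ (Fin d))
      (fun θ : Θ => TangentSpace 𝓘(ℝ, EuclideanSpace ℝ (Fin d)) θ) := by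
  obtain ⟨g, g_smooth, hg⟩ := h.exists_contMDiff
  exact ⟨g, g_smooth.continuous, hg⟩

/-- The choice of radius `r = d / (α T (U + G))` balances the Lipschitz error `G r` against the
entropic cost `-log (e^{-K} c r ^ d) / (α T)` of a ball of radius `r`. -/
lemma radius_tradeoff {d : ℕ} (hd : 0 < d) {α T U G γ K c r : ℝ} (hα : 0 < α) (hT : 0 < T)
    (hU : 0 ≤ U) (hG : 0 ≤ G) (hUG : 0 < U + G) (hγ : 0 ≤ γ) (hc : 0 < c)
    (hr : r = d / (α * T * (U + G))) :
    G * r + γ * G ^ 2 * T / 2 - Real.log (Real.exp (-K) * (c * r ^ d)) / (α * T) ≤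
      (d : ℝ) / (α * T) * (1 - Real.log d + Real.log (α * T * (U + G)))
        + (K + -Real.log c) / (α * T) + γ * (U + G) ^ 2 * T / 2 := by
  have hd' : (0 : ℝ) < d := by exact_mod_cast hd
  have hαT : 0 < α * T := mul_pos hα hT
  have hr0 : 0 < r := by rw [hr]; positivity
  have hlog : Real.log (Real.exp (-K) * (c * r ^ d)) =
      -K + (Real.log c + d * (Real.log d - Real.log (α * T * (U + G)))) := by
    rw [Real.log_mul (Real.exp_pos _).ne' (by positivity), Real.log_exp,
      Real.log_mul hc.ne' (by positivity), Real.log_pow, hr,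
      Real.log_div hd'.ne' (by positivity)]
  have h1 : G * r ≤ d / (α * T) := by
    calc G * r ≤ (U + G) * r := by gcongr; linarith
      _ = d / (α * T) := by rw [hr]; field_simp
  have h2 : γ * G ^ 2 * T / 2 ≤ γ * (U + G) ^ 2 * T / 2 := by
    gcongr; linarith
  rw [hlog]
  have h3 : (d : ℝ) / (α * T) * (1 - Real.log d + Real.log (α * T * (U + G)))
        + (K + -Real.log c) / (α * T) = d / (α * T) -
        (-K + (Real.log c + d * (Real.log d - Real.log (α * T * (U + G))))) / (α * T) := by
    field_simp
    ring
  linarith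

end Radius
end

open AdvTraining in
theorem mainTheorem3 {d : ℕ} (hd : 0 < d)
    {Θ : Type*} [EMetricSpace Θ] [CompactSpace Θ] [MeasurableSpace Θ] [BorelSpace Θ]
    [ChartedSpace (EuclideanSpace ℝ (Fin d)) Θ]
    [IsManifold 𝓘(ℝ, EuclideanSpace ℝ (Fin d)) ∞ Θ]
    [RiemannianBundle (fun θ : Θ => TangentSpace 𝓘(ℝ, EuclideanSpace ℝ (Fin d)) θ)]
    [IsContMDiffRiemannianBundle 𝓘(ℝ, EuclideanSpace ℝ (Fin d)) ∞ (EuclideanSpace ℝ (Fin d))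
      (fun θ : Θ => TangentSpace 𝓘(ℝ, EuclideanSpace ℝ (Fin d)) θ)]
    [IsRiemannianManifold 𝓘(ℝ, EuclideanSpace ℝ (Fin d)) Θ]
    (τ₀ : ℝ) (hτ₀ : 0 < τ₀) :
    ∃ K' : ℝ, ∀ (Y : Type*) (dx N : ℕ), 0 < N →
      ∀ (U : ℝ) (G : ℝ≥0) (𝓧 : Set (Input dx)) (ℓ : Θ → Input dx → Y → ℝ),
      IsAdmissibleLoss d U G 𝓧 ℓ →
      ∀ (ε : ℝ), 0 < ε → ∀ (x : Fin N → Input dx) (y : Fin N → Y),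
      (∀ i, attackBall ε (x i) ⊆ 𝓧) →
      ∀ (K : ℝ) (μ₀ : ProbabilityMeasure Θ) (ν₀ : Fin N → ProbabilityMeasure (Input dx)),
      -- the density of `μ₀` with respect to the Riemannian volume is at least `e^{-K}`
      ENNReal.ofReal (Real.exp (-K)) • (μHE[d] : Measure Θ) ≤ (μ₀ : Measure Θ) →
      ∀ (α γ β : ℝ), 0 < α → 0 ≤ γ → 0 < β →
      ∀ (μ : ℝ → ProbabilityMeasure Θ) (ν : ℝ → Fin N → ProbabilityMeasure (Input dx)),
      IsWFRLBRFlow d α γ β ε ℓ x y μ₀ ν₀ μ ν →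
      ∀ T : ℝ, 0 < T → τ₀ ≤ α * T * (U + G) →
      IntervalIntegrable
        (fun t => risk ℓ y (μ t : Measure Θ) (fun i => (ν t i : Measure (Input dx))))
        volume 0 T ∧
      (∃ μstar : ProbabilityMeasure Θ,
        IsClassifierBestResponse ℓ y (avgAttacker ν T) μstar) ∧
      ∀ μstar : ProbabilityMeasure Θ, IsClassifierBestResponse ℓ y (avgAttacker ν T) μstar →
        (1 / T) * (∫ t in (0 : ℝ)..T,
            risk ℓ y (μ t : Measure Θ) (fun i => (ν t i : Measure (Input dx))))
          - risk ℓ y (μstar : Measure Θ) (avgAttacker ν T) ≤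
          (d : ℝ) / (α * T) * (1 - Real.log d + Real.log (α * T * (U + G)))
            + (K + K') / (α * T) + γ * (U + G) ^ 2 * T / 2 := by
  have : IsContinuousRiemannianBundle (EuclideanSpace ℝ (Fin d))
      (fun θ : Θ => TangentSpace 𝓘(ℝ, EuclideanSpace ℝ (Fin d)) θ) :=
    isContinuousRiemannianBundle_of_isContMDiffRiemannianBundle
  have hd' : (0 : ℝ) < d := by exact_mod_cast hd
  obtain ⟨c, hc0, hc⟩ := exists_measure_eball_ge (d := d) (M := Θ) (d / τ₀) (by positivity)
  refine ⟨-Real.log c, ?_⟩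
  intro Y dx N hN U G 𝓧 ℓ hℓ ε hε x y hx K μ₀ ν₀ hK α γ β hα hγ hβ μ ν hflow T hT hτ
  have hp := hflow.isWFRPath hN hℓ hε hx
  have hU := hp.nonneg_bound
  have hαT : 0 < α * T := mul_pos hα hT
  have hUG : 0 < U + G := pos_of_mul_pos_right (hτ₀.trans_le hτ) hαT.le
  -- the paths are extended to negative times by `max t 0`
  have hrisk : ∀ t, 0 ≤ t →
      risk ℓ y (μ t : Measure Θ) (fun i => (ν t i : Measure (Input dx))) =
        ∫ θ, potential ℓ y (fun i => (ν (max t 0) i : Measure (Input dx))) θ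
          ∂(μ (max t 0) : Measure Θ) := fun t ht => by
    rw [max_eq_left ht, risk_eq_integral_potential hℓ hε hx
      fun i => hflow.attacker_compl_eq_zero ht i]
  have hprob := hflow.isProbabilityMeasure_avgAttacker hℓ hε hx hT
  have hcompl := hflow.avgAttacker_compl_eq_zero hℓ hε hx T
  have hVbar := (lipschitzWith_potential (y := y) hN hℓ hε hx hcompl).continuous
  have hmean : ∀ m : ProbabilityMeasure Θ, risk ℓ y (m : Measure Θ) (avgAttacker ν T) =
      ∫ θ, potential ℓ y (avgAttacker ν T) θ ∂(m : Measure Θ) := fun m =>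
    risk_eq_integral_potential hℓ hε hx hcompl _
  have : Nonempty Θ := nonempty_of_isProbabilityMeasure (μ₀ : Measure Θ)
  obtain ⟨θ, -, hθ⟩ := isCompact_univ.exists_isMinOn univ_nonempty hVbar.continuousOn
  have hmin : ∀ m : ProbabilityMeasure Θ, potential ℓ y (avgAttacker ν T) θ ≤
      risk ℓ y (m : Measure Θ) (avgAttacker ν T) := fun m => by
    rw [hmean]
    calc potential ℓ y (avgAttacker ν T) θ
        = ∫ _, potential ℓ y (avgAttacker ν T) θ ∂(m : Measure Θ) := by simp
      _ ≤ _ := integral_mono (integrable_const _) (hVbar.integrable_of_compact _)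
          fun θ' => hθ (mem_univ θ')
  -- the Dirac mass at `θ` is a best response, and the regret against any `m` is at most that
  -- against `θ`
  refine ⟨?_, ⟨diracProba θ, fun m => ?_⟩, fun m _ => ?_⟩
  · refine (hp.intervalIntegrable_mean 0 T).congr fun t ht => ?_
    rw [uIoc_of_le hT.le] at ht
    exact (hrisk t ht.1.le).symm
  · refine le_trans (le_of_eq ?_) (hmin m)
    rw [hmean]
    exact integral_dirac (potential ℓ y (avgAttacker ν T)) θ
  · set r : ℝ := d / (α * T * (U + G)) with hr
    have hr0 : 0 < r := by positivity
    have hrR : r ≤ d / τ₀ := div_le_div_of_nonneg_left hd'.le hτ₀ hτ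
    have hball : ENNReal.ofReal (Real.exp (-K) * (c * r ^ d)) ≤
        (μ (max 0 0) : Measure Θ) (Metric.eball θ (ENNReal.ofReal r)) := by
      rw [max_self, hflow.classifier.initial, ENNReal.ofReal_mul (Real.exp_pos _).le]
      refine le_trans ?_ (hK _)
      rw [Measure.smul_apply, smul_eq_mul]
      gcongr
      exact hc θ r hr0 hrR
    have hreg := hp.integral_mean_le hα hγ hT.le θ hr0.le (by positivity) hball
    have hV : (∫ t in (0 : ℝ)..T,
        potential ℓ y (fun i => (ν (max t 0) i : Measure (Input dx))) θ) =
        T * potential ℓ y (avgAttacker ν T) θ := by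
      rw [hflow.potential_avgAttacker hℓ hε hx hT, mul_inv_cancel_left₀ hT.ne']
    have hW : (∫ t in (0 : ℝ)..T,
        risk ℓ y (μ t : Measure Θ) (fun i => (ν t i : Measure (Input dx)))) =
        ∫ t in (0 : ℝ)..T, ∫ θ,
          potential ℓ y (fun i => (ν (max t 0) i : Measure (Input dx))) θ
            ∂(μ (max t 0) : Measure Θ) :=
      intervalIntegral.integral_congr fun t ht => by
        rw [uIcc_of_le hT.le] at ht
        exact hrisk t ht.1
    refine le_trans ?_ (radius_tradeoff hd hα hT hU G.coe_nonneg hUG hγ hc0 hr)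
    rw [hW]
    rw [hV] at hreg
    have hreg' := mul_le_mul_of_nonneg_left hreg (one_div_pos.2 hT).le
    have hsplit : 1 / T * (T * potential ℓ y (avgAttacker ν T) θ + T * (G * r)
        + γ * G ^ 2 * T ^ 2 / 2 - Real.log (Real.exp (-K) * (c * r ^ d)) / α) =
        potential ℓ y (avgAttacker ν T) θ + (G * r + γ * G ^ 2 * T / 2
          - Real.log (Real.exp (-K) * (c * r ^ d)) / (α * T)) := by
      field_simp
      ring
    rw [hsplit] at hreg'
    linarith [hmin m]
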